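/- Let $\mathcal G_0=\{C_1,C_2,C_3,C_4,C_5,C_6,C_2^2,C_2^3,C_3^2,D_6,A_4,3_+^{1+2}\}$, where $C_n$ is the cyclic group of order $n$, $D_6$ is the dihedral group of order $6$, $A_4$ is the alternating group of degree $4$, and $3_+^{1+2}$ is the nonabelian group of order $27$ and exponent $3$. For a finite group $G$, let $d(G)$ be the smallest size of a generating set of $G$. For an integer $m\ge 2$, an $m$-Haar graphical representation ($m$-HGR) of a group $G$ is a finite simple regular graph $\Gamma$ whose automorphism group $\operatorname{Aut}(\Gamma)$ is isomorphic to $G$ and acts semiregularly on the vertex set (that is, all vertex stabilizers are trivial) with exactly $m$ orbits, each of which is an independent set (so $\Gamma$ is $m$-partite, with the orbits as parts). Let $G$ be a finite group with $d(G)\le 3$ that is not isomorphic to any group in $\mathcal G_0$. Then $G$ has an $m$-HGR for every integer $m\ge 3$. -/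

import Mathlib

/-- `IsHaarRepresentation m G Γ`: the graph `Γ` is an `m`-Haar graphical representation (`m`-HGR)
of the group `G` (the notion is used for `2 ≤ m`). The automorphism group of `Γ` is `Γ ≃g Γ`,
with its tautological action on the vertex set. -/
structure IsHaarRepresentation (m : ℕ) (G : Type*) [Group G] {V : Type*} (Γ : SimpleGraph V)
    [Γ.LocallyFinite] : Prop where
  /-- `Γ` is a regular graph: all vertices have the same valency. -/
  regular : ∃ d : ℕ, Γ.IsRegularOfDegree d
  /-- The automorphism group of `Γ` is isomorphic to `G`. -/
  aut_iso : Nonempty ((Γ ≃g Γ) ≃* G)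
  /-- The automorphism group acts semiregularly: all vertex stabilizers are trivial. -/
  semiregular : ∀ v : V, MulAction.stabilizer (Γ ≃g Γ) v = ⊥
  /-- `Γ` is `m`-partite, the `m` (nonempty, edgeless) parts being exactly the orbits of the
  automorphism group. -/
  orbits_partition : ∃ C : Γ.Coloring (Fin m), Function.Surjective C ∧
    ∀ u v : V, C u = C v ↔ v ∈ MulAction.orbit (Γ ≃g Γ) u

/-- The group `G` has an `m`-HGR, that is, some finite simple graph is an `m`-HGR of `G`. -/
def HasHaarRepresentation.{u} (m : ℕ) (G : Type u) [Group G] : Prop :=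
  ∃ (V : Type u) (_ : Finite V) (Γ : SimpleGraph V) (_ : Γ.LocallyFinite),
    IsHaarRepresentation m G Γ

/-- `G` is isomorphic to one of the groups in
`𝒢₀ = {C₁, C₂, C₃, C₄, C₅, C₆, C₂², C₂³, C₃², D₆, A₄, 3₊^{1+2}}`, where `D₆` is the dihedral group
of order `6` and `3₊^{1+2}` is the nonabelian group of order `27` and exponent `3`. -/
def InSmallGroups (G : Type*) [Group G] : Prop :=
  (∃ n : ℕ, 1 ≤ n ∧ n ≤ 6 ∧ Nonempty (G ≃* Multiplicative (ZMod n))) ∨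
  Nonempty (G ≃* (Fin 2 → Multiplicative (ZMod 2))) ∨
  Nonempty (G ≃* (Fin 3 → Multiplicative (ZMod 2))) ∨
  Nonempty (G ≃* (Fin 2 → Multiplicative (ZMod 3))) ∨
  Nonempty (G ≃* DihedralGroup 3) ∨
  Nonempty (G ≃* alternatingGroup (Fin 4)) ∨
  (Nat.card G = 27 ∧ Monoid.exponent G = 3 ∧ ∃ a b : G, a * b ≠ b * a)

/-!
An `m`-HGR is constructed as a dense `m`-partite graph: the vertices are the pairs in `G × Fin m`,
and two vertices of different layers `G × {i}`, `G × {j}` are adjacent unless they are *linked* by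
one of a few prescribed labels, `(g, i)` being linked to `(s * g, j)` for the labels `s` of the
pair `i < j`. Right translations preserve such a graph, and it is an `m`-HGR once all vertices
have equally many links and there are no further automorphisms
(`hasHaarRepresentation_of_rigid`). As there are few links, the layers are the only independent
sets of size `|G|`; hence an automorphism permutes the layers and preserves links
(`exists_layer_perm`).

The triangles formed by links are controlled by the choice of labels. Since links with label `1`
are recognized by triangles, an automorphism is given by a single permutation of `G` for all
layers, together with a permutation of the layers. The remaining labels show that the latter is
trivial; then the former commutes with the left translations by the labels, which generate `G`, and
so is a right translation (`eq_mul_right_of_commute`). For `m ≥ 4` the triangles form a strip through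
the first `m - 1` layers, which also orders the layers (`hasHaarRepresentation_of_four_le`). For
`m = 3` there are two constructions: one with labels `x, y, x ^ 2` arranged cyclically
(`hasHaarRepresentation_three_of_pair`), and one with four labels, in which the triangles themselves
are arranged asymmetrically (`hasHaarRepresentation_three_of_labels`).

Suitable labels exist in cyclic groups of order at least seven, in non-cyclic groups with a
generating pair containing an element of order at least four, and in groups with generators
`a, b, c` such that `⟨a, b⟩` is non-cyclic, of order at least six and misses `c`. A group with at
most three generators for which all this fails is one of the excluded groups. If it needs three
generators, then any two of them generate a Klein four-group, so it is elementary abelian. If it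
has two generators, then the members of all generating pairs have order two or three
(`exists_pair_of_not_inSmallGroups`). Pairs of
involutions leave `C₂²` and `D₆`, pairs of both orders leave these and `A₄`, and if only order three
occurs, the group has exponent three and at most `27` elements.
-/

/-! ### Graphs with a prescribed sparse multipartite complement -/

/-- The vertices `u = (g, i)` and `v = (h, j)` of `G × Fin m` in different layers are *linked* with
respect to the family `P` of connection sets if `h * g⁻¹ ∈ P i j` (for `i < j`; the sets `P i j`
with `j ≤ i` play no role). Right translations by elements of `G` preserve this relation. -/
def Link {G : Type*} [Group G] {m : ℕ} (P : ℕ → ℕ → G → Prop) (u v : G × Fin m) : Prop :=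
  (u.2 < v.2 ∧ P u.2 v.2 (v.1 * u.1⁻¹)) ∨ (v.2 < u.2 ∧ P v.2 u.2 (u.1 * v.1⁻¹))

namespace Link

variable {G : Type*} [Group G] {m : ℕ} {P : ℕ → ℕ → G → Prop}

theorem symm {u v : G × Fin m} (h : Link P u v) : Link P v u := Or.symm h

theorem ne {u v : G × Fin m} (h : Link P u v) : u.2 ≠ v.2 := by
  rcases h with h | h
  · exact h.1.ne
  · exact h.1.ne'

theorem mul_right_iff (u v : G × Fin m) (c : G) :
    Link P (u.1 * c, u.2) (v.1 * c, v.2) ↔ Link P u v := by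
  simp [Link, mul_assoc]

theorem iff_of_lt {i j : Fin m} (hij : i < j) (g h : G) :
    Link P (g, i) (h, j) ↔ P i j (h * g⁻¹) := by
  simp [Link, hij, hij.not_gt]

theorem iff_of_gt {i j : Fin m} (hij : j < i) (g h : G) :
    Link P (g, i) (h, j) ↔ P j i (g * h⁻¹) := by
  simp [Link, hij, hij.not_gt]

end Link

/-- The dense `m`-partite graph on `G × Fin m` in which two vertices of different layers are
adjacent exactly when they are not linked. -/
def unlinkedGraph {G : Type*} [Group G] (m : ℕ) (P : ℕ → ℕ → G → Prop) :
    SimpleGraph (G × Fin m) where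
  Adj u v := u.2 ≠ v.2 ∧ ¬ Link P u v
  symm := ⟨fun _ _ h => ⟨h.1.symm, fun h' => h.2 h'.symm⟩⟩
  loopless := ⟨fun _ h => h.1 rfl⟩

section Framework

variable {G : Type*} [Group G] {m : ℕ} {P : ℕ → ℕ → G → Prop}

/-- Right translation by `c⁻¹` as an automorphism of `unlinkedGraph m P`. -/
def translation (m : ℕ) (P : ℕ → ℕ → G → Prop) :
    G →* (unlinkedGraph m P ≃g unlinkedGraph m P) where
  toFun c :=
    { toEquiv := (Equiv.mulRight c⁻¹).prodCongr (Equiv.refl _)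
      map_rel_iff' := by
        intro u v
        have := Link.mul_right_iff (P := P) u v c⁻¹
        simp only [unlinkedGraph]
        exact and_congr Iff.rfl (not_congr this) }
  map_one' := by ext u <;> simp
  map_mul' c d := by
    ext u
    · change u.1 * (c * d)⁻¹ = u.1 * d⁻¹ * c⁻¹
      group
    · rfl

theorem translation_apply (c : G) (u : G × Fin m) :
    translation m P c u = (u.1 * c⁻¹, u.2) := rfl

theorem ncard_link_eq [Finite G] (u : G × Fin m) :
    {v | Link P u v}.ncard = {v | Link P ((1 : G), u.2) v}.ncard := by
  refine Set.ncard_congr (fun v _ => (v.1 * u.1⁻¹, v.2)) ?_ ?_ ?_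
  · intro v hv
    have := (Link.mul_right_iff u v u.1⁻¹).2 hv
    simpa using this
  · intro v w _ _ h
    simp only [Prod.mk.injEq, mul_left_inj] at h
    exact Prod.ext h.1 h.2
  · intro v hv
    refine ⟨(v.1 * u.1, v.2), ?_, by simp⟩
    have := (Link.mul_right_iff ((1 : G), u.2) v u.1).2 hv
    simpa using this

/-- If every vertex is linked to exactly `D` others, and every automorphism of the unlinked graph
is a right translation, then the unlinked graph is an `m`-HGR of `G`. -/
theorem hasHaarRepresentation_of_rigid [Finite G] (hm : 0 < m) (D : ℕ)
    (hD : ∀ i : Fin m, {v | Link P ((1 : G), i) v}.ncard = D)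
    (hrigid : ∀ f : unlinkedGraph m P ≃g unlinkedGraph m P,
      ∃ c : G, ∀ u, f u = (u.1 * c, u.2)) :
    HasHaarRepresentation m G := by
  let : (unlinkedGraph m P).LocallyFinite := fun v => Fintype.ofFinite _
  refine ⟨G × Fin m, inferInstance, unlinkedGraph m P, inferInstance, ?_⟩
  have haut : ∀ f : unlinkedGraph m P ≃g unlinkedGraph m P, ∃ c, translation m P c = f := by
    intro f
    obtain ⟨c, hc⟩ := hrigid f
    refine ⟨c⁻¹, ?_⟩
    refine RelIso.ext fun u => ?_
    rw [translation_apply, hc, inv_inv]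
  refine ⟨⟨m * Nat.card G - Nat.card G - D, ?_⟩, ?_, ?_, ?_⟩
  · intro u
    rw [← SimpleGraph.card_neighborSet_eq_degree, ← Nat.card_eq_fintype_card,
      Nat.card_coe_set_eq]
    have h1 : (unlinkedGraph m P).neighborSet u =
        ({v : G × Fin m | v.2 = u.2}ᶜ \ {v | Link P u v}) := by
      ext v
      simp [unlinkedGraph, eq_comm]
    have h2 : {v : G × Fin m | v.2 = u.2}.ncard = Nat.card G := by
      have : {v : G × Fin m | v.2 = u.2} = (fun g : G => (g, u.2)) '' Set.univ := by
        ext ⟨g, i⟩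
        simp [eq_comm]
      rw [this, Set.ncard_image_of_injective _ (fun a b h => by simpa using h), Set.ncard_univ]
    rw [h1, Set.ncard_sdiff, Set.ncard_compl, h2, ncard_link_eq, hD, Nat.card_prod, Nat.card_fin,
      mul_comm]
    intro v hv
    exact hv.ne.symm
  · refine ⟨(MulEquiv.ofBijective (translation m P) ⟨?_, haut⟩).symm⟩
    rw [injective_iff_map_eq_one]
    intro c hc
    have := congrArg (fun f => (f ((1 : G), (⟨0, hm⟩ : Fin m))).1) hc
    simpa [translation_apply] using this
  · intro v
    rw [eq_bot_iff]
    intro f hf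
    obtain ⟨c, rfl⟩ := haut f
    have h1 : translation m P c v = v := hf
    have h2 : c = 1 := by simpa [translation_apply, Prod.ext_iff] using h1
    simp [h2]
  · refine ⟨SimpleGraph.Coloring.mk Prod.snd fun h => h.1, fun i => ⟨(1, i), rfl⟩, ?_⟩
    intro u v
    change u.2 = v.2 ↔ _
    constructor
    · intro h
      refine ⟨translation m P (v.1⁻¹ * u.1), ?_⟩
      change translation m P (v.1⁻¹ * u.1) u = v
      rw [translation_apply]
      exact Prod.ext (by simp) h
    · rintro ⟨f, rfl⟩
      obtain ⟨c, rfl⟩ := haut f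
      rfl

/-- If the layers are the only independent sets of size `|G|`, then an automorphism of the
unlinked graph permutes the layers and preserves the link relation. -/
theorem exists_layer_perm [Finite G]
    (hlayer : ∀ q : G → G × Fin m, Function.Injective q →
      (∀ g h, (q g).2 ≠ (q h).2 → Link P (q g) (q h)) → ∀ g h, (q g).2 = (q h).2)
    (f : unlinkedGraph m P ≃g unlinkedGraph m P) :
    ∃ (p : Fin m → G → G) (σ : Equiv.Perm (Fin m)), (∀ g i, f (g, i) = (p i g, σ i)) ∧
      (∀ i, Function.Injective (p i)) ∧
      ∀ g h i j, Link P (g, i) (h, j) → Link P (p i g, σ i) (p j h, σ j) := by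
  have hf : ∀ g i, f (g, i) = ((f (g, i)).1, (f ((1 : G), i)).2) := by
    intro g i
    refine Prod.ext rfl ?_
    refine hlayer (fun g => f (g, i)) (fun a b h => by simpa using h) ?_ g 1
    intro g h hne
    by_contra hl
    have hadj : (unlinkedGraph m P).Adj (f (g, i)) (f (h, i)) := ⟨hne, hl⟩
    exact (f.map_adj_iff.1 hadj).1 rfl
  have hsurj : Function.Surjective fun i => (f ((1 : G), i)).2 := by
    intro j
    obtain ⟨⟨g, i⟩, hgi⟩ := f.surjective ((1 : G), j)
    refine ⟨i, ?_⟩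
    have := hf g i
    rw [hgi] at this
    exact (congrArg Prod.snd this).symm
  refine ⟨fun i g => (f (g, i)).1,
    Equiv.ofBijective _ (Finite.injective_iff_bijective.1 (Finite.injective_iff_surjective.2 hsurj)),
    hf, ?_, ?_⟩
  · intro i g h hgh
    have : f (g, i) = f (h, i) := by
      rw [hf g, hf h]
      exact Prod.ext hgh rfl
    simpa using this
  · intro g h i j hl
    have hij := hl.ne
    simp only [Equiv.ofBijective_apply]
    rw [← hf, ← hf]
    by_contra hn
    have hne : (f (g, i)).2 ≠ (f (h, j)).2 := by
      rw [hf g, hf h]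
      exact fun h => hij (Finite.injective_iff_surjective.2 hsurj h)
    exact (f.map_adj_iff.1 ⟨hne, hn⟩).2 hl

theorem ncard_link_layer_le {k : ℕ}
    (hP : ∀ i j, i < j → j < m → ∃ T : Finset G, T.card ≤ k ∧ ∀ s, P i j s → s ∈ T)
    (u : G × Fin m) (j : Fin m) : {w | w.2 = j ∧ Link P u w}.ncard ≤ k := by
  have key : ∀ (T : Finset G) (φ : G → G × Fin m), T.card ≤ k →
      {w | w.2 = j ∧ Link P u w} ⊆ φ '' T → {w | w.2 = j ∧ Link P u w}.ncard ≤ k := by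
    intro T φ hT hsub
    refine (Set.ncard_le_ncard hsub (T.finite_toSet.image φ)).trans ?_
    refine (Set.ncard_image_le T.finite_toSet).trans ?_
    rwa [Set.ncard_coe_finset]
  rcases lt_trichotomy u.2 j with h | h | h
  · obtain ⟨T, hT, hmem⟩ := hP _ _ h j.2
    refine key T (fun s => (s * u.1, j)) hT ?_
    rintro ⟨w, _⟩ ⟨rfl, hw⟩
    exact ⟨_, hmem _ ((Link.iff_of_lt h _ _).1 hw), by simp⟩
  · refine key ∅ (fun s => (s, j)) (by simp) ?_
    rintro ⟨w, _⟩ ⟨rfl, hw⟩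
    exact absurd h hw.ne
  · obtain ⟨T, hT, hmem⟩ := hP _ _ h u.2.2
    refine key T (fun s => (s⁻¹ * u.1, j)) hT ?_
    rintro ⟨w, _⟩ ⟨rfl, hw⟩
    exact ⟨_, hmem _ ((Link.iff_of_gt h _ _).1 hw), by simp⟩

/-- The layers are the only independent sets of size `|G| ≥ 7` if every vertex is linked to at
most four others, at most two of them in any given layer: an independent set meeting two layers
in `u` and `v` consists of vertices linked to `u`, together with vertices in the layer
of `u` that are linked to `v`. -/
theorem layer_of_link_le [Finite G] (hcard : 7 ≤ Nat.card G)
    (hD : ∀ i : Fin m, {v | Link P ((1 : G), i) v}.ncard ≤ 4)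
    (hP : ∀ i j, i < j → j < m → ∃ T : Finset G, T.card ≤ 2 ∧ ∀ s, P i j s → s ∈ T)
    (q : G → G × Fin m) (hq : Function.Injective q)
    (hlink : ∀ g h, (q g).2 ≠ (q h).2 → Link P (q g) (q h)) (g h : G) :
    (q g).2 = (q h).2 := by
  by_contra hne
  have hsub : Set.range q ⊆
      {w | Link P (q g) w} ∪ {w | w.2 = (q g).2 ∧ Link P (q h) w} := by
    rintro _ ⟨k, rfl⟩
    by_cases hk : (q k).2 = (q g).2
    · exact Or.inr ⟨hk, hlink h k (hk ▸ Ne.symm hne)⟩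
    · exact Or.inl (hlink g k (Ne.symm hk))
  have h1 : (Set.range q).ncard = Nat.card G := by
    rw [← Set.image_univ, Set.ncard_image_of_injective _ hq, Set.ncard_univ]
  have h2 := ncard_link_layer_le hP (q h) (q g).2
  have h3 := hD (q g).2
  rw [← ncard_link_eq] at h3
  have h4 := Set.ncard_le_ncard hsub
  have h5 := Set.ncard_union_le {w | Link P (q g) w} {w | w.2 = (q g).2 ∧ Link P (q h) w}
  omega

/-- A self-map of `G` commuting with the left translations by a generating set is a right
translation. -/
theorem eq_mul_right_of_commute {p : G → G} {X : Set G} (hX : Subgroup.closure X = ⊤)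
    (hp : ∀ x ∈ X, ∀ g, p (x * g) = x * p g) (g : G) : p g = g * p 1 := by
  have key : ∀ s : G, ∀ g, p (s * g) = s * p g := by
    intro s
    have hs : s ∈ Subgroup.closure X := hX ▸ Subgroup.mem_top s
    induction hs using Subgroup.closure_induction with
    | mem x hx => exact hp x hx
    | one => simp
    | mul x y _ _ hx hy => intro g; rw [mul_assoc, hx, hy, mul_assoc]
    | inv x _ hx =>
      intro g
      have := hx (x⁻¹ * g)
      rw [mul_inv_cancel_left] at this
      rw [this, inv_mul_cancel_left]
  simpa using key g 1

end Framework

/-! ### At least four layers -/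

section FourLayers

variable {G : Type*} [Group G] {m : ℕ} {a v b : G}

/-- Connection sets for `m ≥ 4` layers. The sets `{1}` join the layers at distance one or two,
which makes a strip of triangles; the last triangle of the strip is broken by the label `v`.
The remaining labels `a` (layers `1`, `m - 2`) and `a, b` (layers `0`, `m - 1`) make every vertex
have four links. For `m = 4` and `m = 5` two of the clauses apply to the layers `1`, `m - 2`. -/
def stripConnection (m : ℕ) (a v b : G) (i j : ℕ) (s : G) : Prop :=
  (j = i + 1 ∧ s = 1) ∨ (j = i + 2 ∧ j + 1 < m ∧ s = 1) ∨ (j = i + 2 ∧ j + 1 = m ∧ s = v) ∨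
    (i = 1 ∧ j + 2 = m ∧ s = a) ∨ (i = 0 ∧ j + 1 = m ∧ (s = a ∨ s = b))

theorem ncard_insert_four {α : Type*} {w x y z : α} (h1 : w ≠ x) (h2 : w ≠ y) (h3 : w ≠ z)
    (h4 : x ≠ y) (h5 : x ≠ z) (h6 : y ≠ z) : ({w, x, y, z} : Set α).ncard = 4 := by
  rw [Set.ncard_insert_of_notMem (by simp [*]), Set.ncard_insert_of_notMem (by simp [*]),
    Set.ncard_pair h6]

theorem ncard_link_stripConnection (hm : 4 ≤ m) (ha : a ≠ 1) (hva : v ≠ a) (hba : b ≠ a)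
    (i : Fin m) : {u | Link (stripConnection m a v b) ((1 : G), i) u}.ncard = 4 := by
  obtain ⟨i, hi⟩ := i
  have key : ∀ (s : G) (j : ℕ) (hj : j < m),
      Link (stripConnection m a v b) ((1 : G), ⟨i, hi⟩) (s, ⟨j, hj⟩) ↔
      (i < j ∧ stripConnection m a v b i j s) ∨ (j < i ∧ stripConnection m a v b j i s⁻¹) := by
    intro s j hj
    simp [Link]
  have hset : ∀ w x y z : G × Fin m,
      (∀ (s : G) (j : ℕ) (hj : j < m),
        ((i < j ∧ stripConnection m a v b i j s) ∨ (j < i ∧ stripConnection m a v b j i s⁻¹)) ↔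
        ((s, ⟨j, hj⟩) = w ∨ (s, ⟨j, hj⟩) = x ∨ (s, ⟨j, hj⟩) = y ∨ (s, ⟨j, hj⟩) = z)) →
      {u | Link (stripConnection m a v b) ((1 : G), (⟨i, hi⟩ : Fin m)) u} = {w, x, y, z} := by
    intro w x y z h
    ext ⟨s, j, hj⟩
    exact (key s j hj).trans (h s j hj)
  have hinv : ∀ s t : G, s⁻¹ = t ↔ s = t⁻¹ := fun s t => inv_eq_iff_eq_inv
  rcases Nat.lt_or_ge i 2 with h2 | h2
  · rcases Nat.lt_or_ge i 1 with h1 | h1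
    · obtain rfl : i = 0 := by omega
      rw [hset (1, ⟨1, by omega⟩) (1, ⟨2, by omega⟩) (a, ⟨m - 1, by omega⟩) (b, ⟨m - 1, by omega⟩)]
      · apply ncard_insert_four <;> simp <;> grind
      · intro s j hj
        simp only [stripConnection, Prod.mk.injEq, Fin.mk.injEq]
        grind (splits := 20)
    · obtain rfl : i = 1 := by omega
      rw [hset (1, ⟨0, by omega⟩) (1, ⟨2, by omega⟩) (if m = 4 then v else 1, ⟨3, by omega⟩)
        (a, ⟨m - 2, by omega⟩)]
      · apply ncard_insert_four <;> simp <;> grind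
      · intro s j hj
        simp only [stripConnection, Prod.mk.injEq, Fin.mk.injEq, hinv, inv_one]
        grind (splits := 20)
  · rcases Nat.lt_or_ge i (m - 2) with h3 | h3
    · rw [hset (1, ⟨i - 2, by omega⟩) (1, ⟨i - 1, by omega⟩) (1, ⟨i + 1, by omega⟩)
        (if i + 3 = m then v else 1, ⟨i + 2, by omega⟩)]
      · apply ncard_insert_four <;> simp <;> grind
      · intro s j hj
        simp only [stripConnection, Prod.mk.injEq, Fin.mk.injEq, hinv, inv_one]
        grind (splits := 20)
    · rcases Nat.lt_or_ge i (m - 1) with h4 | h4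
      · obtain rfl : i = m - 2 := by omega
        rw [hset (1, ⟨m - 4, by omega⟩) (1, ⟨m - 3, by omega⟩) (1, ⟨m - 1, by omega⟩)
          (a⁻¹, ⟨1, by omega⟩)]
        · apply ncard_insert_four <;> simp <;> grind
        · intro s j hj
          simp only [stripConnection, Prod.mk.injEq, Fin.mk.injEq, hinv, inv_one]
          grind (splits := 20)
      · obtain rfl : i = m - 1 := by omega
        rw [hset (1, ⟨m - 2, by omega⟩) (v⁻¹, ⟨m - 3, by omega⟩) (a⁻¹, ⟨0, by omega⟩)
          (b⁻¹, ⟨0, by omega⟩)]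
        · apply ncard_insert_four <;> simp <;> grind
        · intro s j hj
          simp only [stripConnection, Prod.mk.injEq, Fin.mk.injEq, hinv, inv_one]
          grind (splits := 20)

theorem stripConnection_le_two (hm : 4 ≤ m) (i j : ℕ) :
    ∃ T : Finset G, T.card ≤ 2 ∧ ∀ r, stripConnection m a v b i j r → r ∈ T := by
  classical
  have key : ∀ s t : G, (∀ r, stripConnection m a v b i j r → r = s ∨ r = t) →
      ∃ T : Finset G, T.card ≤ 2 ∧ ∀ r, stripConnection m a v b i j r → r ∈ T :=
    fun s t h => ⟨{s, t}, Finset.card_le_two, by simpa using h⟩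
  by_cases h : j + 1 = m
  · by_cases h0 : i = 0
    · exact key a b fun r hr => by unfold stripConnection at hr; grind
    · exact key 1 v fun r hr => by unfold stripConnection at hr; grind
  · exact key 1 a fun r hr => by unfold stripConnection at hr; grind

/-- Three distinct numbers below `m - 1` that are consecutive in some order. -/
def IsConsecutive (m i j k : ℕ) : Prop :=
  i ≠ j ∧ j ≠ k ∧ i ≠ k ∧ i ≤ j + 2 ∧ j ≤ i + 2 ∧ j ≤ k + 2 ∧ k ≤ j + 2 ∧ i ≤ k + 2 ∧ k ≤ i + 2 ∧
    i + 1 < m ∧ j + 1 < m ∧ k + 1 < m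

theorem triangle_of_lt (hm : 4 ≤ m) (ha : a ≠ 1) (hv : v ≠ 1) (hva : v ≠ a) (hb : b ≠ 1)
    (hbv : b ≠ v) {i j k : Fin m} (hij : i < j) (hjk : j < k) {g h l : G}
    (h1 : Link (stripConnection m a v b) (g, i) (h, j))
    (h2 : Link (stripConnection m a v b) (h, j) (l, k))
    (h3 : Link (stripConnection m a v b) (g, i) (l, k)) :
    IsConsecutive m i j k ∧ g = h ∧ h = l := by
  rw [Link.iff_of_lt hij] at h1
  rw [Link.iff_of_lt hjk] at h2
  rw [Link.iff_of_lt (hij.trans hjk)] at h3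
  have hmul : l * g⁻¹ = (l * h⁻¹) * (h * g⁻¹) := by group
  have e1 : h * g⁻¹ = 1 → g = h := fun h => (mul_inv_eq_one.1 h).symm
  have e2 : l * h⁻¹ = 1 → h = l := fun h => (mul_inv_eq_one.1 h).symm
  rw [hmul] at h3
  obtain ⟨i, hi⟩ := i
  obtain ⟨j, hj⟩ := j
  obtain ⟨k, hk⟩ := k
  simp only [Fin.mk_lt_mk] at hij hjk
  generalize h * g⁻¹ = s at *
  generalize l * h⁻¹ = t at *
  simp only [stripConnection, IsConsecutive] at *
  rcases h1 with h1 | h1 | h1 | h1 | h1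
  · obtain ⟨h1, rfl⟩ := h1
    rw [mul_one] at h3
    rcases h2 with h2 | h2 | h2 | h2 | h2 <;> grind (splits := 20)
  · obtain ⟨h1, h1', rfl⟩ := h1
    rw [mul_one] at h3
    rcases h2 with h2 | h2 | h2 | h2 | h2 <;> grind (splits := 20)
  · omega
  · obtain ⟨rfl, h1, rfl⟩ := h1
    have ht : t = 1 := by
      rcases h2 with h2 | h2 | h2 | h2 | h2
      · exact h2.2
      all_goals omega
    rw [ht, one_mul] at h3
    rcases h3 with h3 | h3 | h3 | h3 | h3
    · omega
    · omega
    · exact absurd h3.2.2.symm hva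
    all_goals omega
  · omega

/-- The only triangles of links consist of three vertices with the same first coordinate, in three
consecutive layers before the last one. -/
theorem triangle_stripConnection (hm : 4 ≤ m) (ha : a ≠ 1) (hv : v ≠ 1) (hva : v ≠ a) (hb : b ≠ 1)
    (hbv : b ≠ v) {i j k : Fin m} {g h l : G}
    (h1 : Link (stripConnection m a v b) (g, i) (h, j))
    (h2 : Link (stripConnection m a v b) (h, j) (l, k))
    (h3 : Link (stripConnection m a v b) (g, i) (l, k)) :
    IsConsecutive m i j k ∧ g = h ∧ h = l := by
  have n1 := h1.ne
  have n2 := h2.ne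
  have n3 := h3.ne
  simp only at n1 n2 n3
  have key := @triangle_of_lt G _ m a v b hm ha hv hva hb hbv
  rcases lt_or_gt_of_ne n1 with l1 | l1 <;> rcases lt_or_gt_of_ne n2 with l2 | l2 <;>
    rcases lt_or_gt_of_ne n3 with l3 | l3
  · exact key l1 l2 h1 h2 h3
  · omega
  · obtain ⟨hc, rfl, rfl⟩ := key l3 l2 h3 h2.symm h1
    exact ⟨by unfold IsConsecutive at *; omega, rfl, rfl⟩
  · obtain ⟨hc, rfl, rfl⟩ := key l3 l1 h3.symm h1 h2.symm
    exact ⟨by unfold IsConsecutive at *; omega, rfl, rfl⟩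
  · obtain ⟨hc, rfl, rfl⟩ := key l1 l3 h1.symm h3 h2
    exact ⟨by unfold IsConsecutive at *; omega, rfl, rfl⟩
  · obtain ⟨hc, rfl, rfl⟩ := key l2 l3 h2 h3.symm h1.symm
    exact ⟨by unfold IsConsecutive at *; omega, rfl, rfl⟩
  · omega
  · obtain ⟨hc, rfl, rfl⟩ := key l2 l1 h2.symm h1.symm h3.symm
    exact ⟨by unfold IsConsecutive at *; omega, rfl, rfl⟩

/-- A permutation of the layers that preserves consecutive triples below `m - 1` and fixes the
first and the last layer is trivial, provided that it also preserves the pair of layers `m - 3`,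
`m - 2` linked to the last one (a condition that matters only for `m = 5`). -/
theorem eq_self_of_isConsecutive (hm : 5 ≤ m) {τ : ℕ → ℕ}
    (hinj : ∀ i j, i < m → j < m → τ i = τ j → i = j)
    (h0 : τ 0 = 0) (hlast : τ (m - 1) = m - 1)
    (hT : ∀ i, i + 3 < m → IsConsecutive m (τ i) (τ (i + 1)) (τ (i + 2)))
    (hE : τ (m - 3) = m - 3 ∨ τ (m - 3) = m - 2) (i : ℕ) (hi : i < m) : τ i = i := by
  have t0 := hT 0 (by omega)
  have t1 := hT 1 (by omega)
  simp only [IsConsecutive, h0, zero_add, Nat.reduceAdd] at t0 t1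
  have i1 := hinj 0 3 (by omega) (by omega)
  have h1 : τ 1 = 1 := by
    by_contra hne
    have e1 : τ 1 = 2 := by omega
    have e2 : τ 2 = 1 := by omega
    by_cases h5 : m = 5
    · subst h5
      simp only [Nat.reduceSub] at hE
      omega
    · have t2 := hT 2 (by omega)
      have i2 := hinj 1 4 (by omega) (by omega)
      simp only [IsConsecutive, Nat.reduceAdd] at t2
      omega
  have h2 : τ 2 = 2 := by omega
  induction i using Nat.strong_induction_on with
  | _ i ih =>
    rcases Nat.lt_or_ge i 3 with h3 | h3
    · interval_cases i <;> assumption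
    · obtain ⟨k, rfl⟩ := Nat.exists_eq_add_of_le' h3
      by_cases hk : k + 4 = m
      · rw [← hk] at hlast
        exact hlast
      · have t := hT (k + 1) (by omega)
        have e0 := ih k (by omega) (by omega)
        have e1 := ih (k + 1) (by omega) (by omega)
        have e2 := ih (k + 2) (by omega) (by omega)
        have := hinj k (k + 3) (by omega) (by omega)
        simp only [IsConsecutive, add_assoc, Nat.reduceAdd, e1, e2] at t
        omega

/-- The strip of triangles determines the layers and hence makes the graph rigid. The layer
`m - 1` is the only one that meets no triangle, and the layer `0` is the only one joined to it by
two labels. For `m ≥ 5` this fixes all layers; the flip that remains for `m = 4` would force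
`v * a⁻¹ ∈ {a, b}`. -/
theorem hasHaarRepresentation_of_four_le [Finite G] (hm : 4 ≤ m) (hcard : 7 ≤ Nat.card G)
    (ha : a ≠ 1) (hv : v ≠ 1) (hva : v ≠ a) (hvaa : v ≠ a * a) (hb : b ≠ 1) (hbv : b ≠ v)
    (hba : b ≠ a) (hbva : b ≠ v * a⁻¹) (hgen : Subgroup.closure {a, v, b} = ⊤) :
    HasHaarRepresentation m G := by
  have hD := fun i : Fin m => ncard_link_stripConnection (G := G) hm ha hva hba i
  refine hasHaarRepresentation_of_rigid (P := stripConnection m a v b) (by omega) 4 hD ?_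
  intro f
  obtain ⟨p, σ, hf, hp, hlink⟩ := exists_layer_perm (layer_of_link_le hcard (fun i => (hD i).le)
    fun i j _ _ => stripConnection_le_two hm i j) f
  have triangle : ∀ {i j k : Fin m} {g h l : G}, Link (stripConnection m a v b) (g, i) (h, j) →
      Link (stripConnection m a v b) (h, j) (l, k) →
      Link (stripConnection m a v b) (g, i) (l, k) → IsConsecutive m i j k ∧ g = h ∧ h = l :=
    triangle_stripConnection hm ha hv hva hb hbv
  -- the links, with the layers given by natural numbers
  have mk : ∀ (s : G) (i j : ℕ) (hi : i < m) (hj : j < m), i < j → stripConnection m a v b i j s →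
      ∀ g, Link (stripConnection m a v b) (p ⟨i, hi⟩ g, σ ⟨i, hi⟩)
        (p ⟨j, hj⟩ (s * g), σ ⟨j, hj⟩) := by
    intro s i j hi hj hij hs g
    refine hlink _ _ _ _ ((Link.iff_of_lt (by exact hij) _ _).2 ?_)
    simpa using hs
  have strip : ∀ (i : ℕ) (hi : i + 3 < m) (g : G),
      IsConsecutive m (σ ⟨i, by omega⟩) (σ ⟨i + 1, by omega⟩) (σ ⟨i + 2, by omega⟩) ∧
      p ⟨i, by omega⟩ g = p ⟨i + 1, by omega⟩ g ∧
      p ⟨i + 1, by omega⟩ g = p ⟨i + 2, by omega⟩ g := by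
    intro i hi g
    have h1 := mk 1 i (i + 1) (by omega) (by omega) (by omega) (.inl ⟨rfl, rfl⟩) g
    have h2 := mk 1 (i + 1) (i + 2) (by omega) (by omega) (by omega) (.inl ⟨rfl, rfl⟩) g
    have h3 := mk 1 i (i + 2) (by omega) (by omega) (by omega) (.inr (.inl ⟨rfl, by omega, rfl⟩)) g
    rw [one_mul] at h1 h2 h3
    exact triangle h1 h2 h3
  have σlast : ∀ h : m - 1 < m, σ ⟨m - 1, h⟩ = ⟨m - 1, h⟩ := by
    intro h
    obtain ⟨⟨i, hi⟩, hσ⟩ := σ.surjective ⟨m - 1, h⟩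
    by_cases him : i = m - 1
    · subst him
      exact hσ
    · exfalso
      have hσ' : ((σ ⟨i, hi⟩ : Fin m) : ℕ) = m - 1 := by rw [hσ]
      rcases Nat.lt_or_ge (i + 3) m with h3 | h3
      · have := (strip i h3 1).1
        simp only [IsConsecutive] at this
        omega
      · rcases Nat.lt_or_ge (i + 2) m with h2 | h2
        · obtain ⟨i, rfl⟩ : ∃ k, i = k + 1 := ⟨i - 1, by omega⟩
          have := (strip i (by omega) 1).1
          simp only [IsConsecutive] at this
          omega
        · obtain ⟨i, rfl⟩ : ∃ k, i = k + 2 := ⟨i - 2, by omega⟩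
          have := (strip i (by omega) 1).1
          simp only [IsConsecutive] at this
          omega
  have link_last : ∀ (i : Fin m) (h : m - 1 < m) (g l : G), i ≠ ⟨m - 1, h⟩ →
      Link (stripConnection m a v b) (g, i) (l, ⟨m - 1, h⟩) →
      stripConnection m a v b i (m - 1) (l * g⁻¹) := by
    intro i h g l hi hl
    have hne : (i : ℕ) ≠ m - 1 := fun h' => hi (Fin.ext h')
    exact (Link.iff_of_lt (show i < ⟨m - 1, h⟩ from Fin.lt_def.2 (by simp; omega)) _ _).1 hl
  have σne : ∀ (i : ℕ) (hi : i < m) (h : m - 1 < m), i ≠ m - 1 → σ ⟨i, hi⟩ ≠ ⟨m - 1, h⟩ := by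
    intro i hi h hne h'
    rw [← σlast h] at h'
    exact hne (by simpa using σ.injective h')
  have σzero : ∀ h : 0 < m, σ ⟨0, h⟩ = ⟨0, h⟩ := by
    intro h
    have h1 := mk a 0 (m - 1) h (by omega) (by omega)
      (.inr (.inr (.inr (.inr ⟨rfl, by omega, .inl rfl⟩)))) 1
    have h2 := mk b 0 (m - 1) h (by omega) (by omega)
      (.inr (.inr (.inr (.inr ⟨rfl, by omega, .inr rfl⟩)))) 1
    rw [σlast] at h1 h2
    have hne := σne 0 h (by omega) (by omega)
    have c1 := link_last _ _ _ _ hne h1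
    have c2 := link_last _ _ _ _ hne h2
    have hab : p ⟨m - 1, by omega⟩ (a * 1) * (p ⟨0, h⟩ 1)⁻¹ ≠
        p ⟨m - 1, by omega⟩ (b * 1) * (p ⟨0, h⟩ 1)⁻¹ := by
      intro h'
      exact hba (by simpa using (hp _ (mul_right_cancel h')).symm)
    refine Fin.ext ?_
    simp only [stripConnection] at c1 c2
    by_contra h0
    have h0' : ((σ ⟨0, h⟩ : Fin m) : ℕ) ≠ 0 := h0
    apply hab
    grind (splits := 20)
  have adj_last : ∀ (i : ℕ) (hi : i < m), i + 3 = m ∨ i + 2 = m →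
      ((σ ⟨i, hi⟩ : Fin m) : ℕ) + 3 = m ∨ ((σ ⟨i, hi⟩ : Fin m) : ℕ) + 2 = m := by
    intro i hi him
    have hne := σne i hi (by omega) (by omega)
    have hne0 : ((σ ⟨i, hi⟩ : Fin m) : ℕ) ≠ 0 := by
      intro h'
      have : σ ⟨i, hi⟩ = σ ⟨0, by omega⟩ := by rw [σzero]; exact Fin.ext h'
      have := σ.injective this
      simp only [Fin.mk.injEq] at this
      omega
    have hs : ∃ s, stripConnection m a v b i (m - 1) s := by
      rcases him with him | him
      · exact ⟨v, .inr (.inr (.inl ⟨by omega, by omega, rfl⟩))⟩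
      · exact ⟨1, .inl ⟨by omega, rfl⟩⟩
    obtain ⟨s, hs⟩ := hs
    have h1 := mk s i (m - 1) hi (by omega) (by omega) hs 1
    rw [σlast] at h1
    have c1 := link_last _ _ _ _ hne h1
    simp only [stripConnection] at c1
    omega
  have h0m : 0 < m := by omega
  have hlm : m - 1 < m := by omega
  have pcommon : ∀ (i : ℕ) (hi : i < m), i + 1 < m → p ⟨i, hi⟩ = p ⟨0, h0m⟩ := by
    intro i hi
    induction i with
    | zero => exact fun _ => rfl
    | succ i ih =>
      intro h
      rw [← ih (by omega) (by omega)]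
      funext g
      by_cases h3 : i + 3 < m
      · exact (strip i h3 g).2.1.symm
      · obtain ⟨k, rfl⟩ : ∃ k, i = k + 1 := ⟨i - 1, by omega⟩
        exact (strip k (by omega) g).2.2.symm
  have hinj0 := hp ⟨0, h0m⟩
  set q := p ⟨0, h0m⟩ with hq
  have qmul : ∀ s g, q (s * g) * (q g)⁻¹ = 1 → s = 1 := by
    intro s g h
    simpa using hinj0 (mul_inv_eq_one.1 h)
  -- the link labelled `a` between the layers `1` and `m - 2`
  have la := fun g => mk a 1 (m - 2) (by omega) (by omega) (by omega)
    (.inr (.inr (.inr (.inl ⟨rfl, by omega, rfl⟩)))) g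
  have lv := fun g => mk v (m - 3) (m - 1) (by omega) (by omega) (by omega)
    (.inr (.inr (.inl ⟨by omega, by omega, rfl⟩))) g
  have l1 := fun g => mk 1 (m - 2) (m - 1) (by omega) (by omega) (by omega)
    (.inl ⟨by omega, rfl⟩) g
  have l0 := fun g => mk a 0 (m - 1) (by omega) (by omega) (by omega)
    (.inr (.inr (.inr (.inr ⟨rfl, by omega, .inl rfl⟩)))) g
  have l0' := fun g => mk b 0 (m - 1) (by omega) (by omega) (by omega)
    (.inr (.inr (.inr (.inr ⟨rfl, by omega, .inr rfl⟩)))) g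
  simp only [σlast, σzero, pcommon 1 (by omega) (by omega),
    pcommon (m - 2) (by omega) (by omega), pcommon (m - 3) (by omega) (by omega),
    one_mul, ← hq] at la lv l1 l0 l0'
  have lt_last : ∀ (i : ℕ) (hi : i < m), i < m - 1 →
      (⟨i, hi⟩ : Fin m) < ⟨m - 1, hlm⟩ := fun i hi h => h
  have hσ : ∀ (i : ℕ) (hi : i < m), σ ⟨i, hi⟩ = ⟨i, hi⟩ := by
    let τ : ℕ → ℕ := fun i => if hi : i < m then (σ ⟨i, hi⟩ : Fin m) else 0
    have hτ : ∀ (i : ℕ) (hi : i < m), τ i = (σ ⟨i, hi⟩ : Fin m) := fun i hi => dif_pos hi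
    have hinj : ∀ i j, i < m → j < m → τ i = τ j → i = j := by
      intro i j hi hj h
      rw [hτ i hi, hτ j hj] at h
      simpa using σ.injective (Fin.ext h)
    have hT : ∀ i, i + 3 < m → IsConsecutive m (τ i) (τ (i + 1)) (τ (i + 2)) := by
      intro i hi
      rw [hτ i (by omega), hτ (i + 1) (by omega), hτ (i + 2) (by omega)]
      exact (strip i hi 1).1
    have h0 : τ 0 = 0 := by rw [hτ 0 h0m, σzero]
    have hl : τ (m - 1) = m - 1 := by rw [hτ _ hlm, σlast]
    intro i hi
    refine Fin.ext ?_
    rw [← hτ i hi]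
    by_cases h5 : 5 ≤ m
    · refine eq_self_of_isConsecutive h5 hinj h0 hl hT ?_ i hi
      have := adj_last (m - 3) (by omega) (by omega)
      rw [← hτ] at this
      omega
    · obtain rfl : m = 4 := by omega
      have t0 := hT 0 (by omega)
      simp only [IsConsecutive, h0, zero_add] at t0
      have h1 : τ 1 = 1 := by
        by_contra hne
        have e1 : τ 1 = 2 := by omega
        have e2 : τ 2 = 1 := by omega
        rw [hτ 1 (by omega)] at e1
        rw [hτ 2 (by omega)] at e2
        have s1 : σ ⟨1, by omega⟩ = ⟨2, by omega⟩ := Fin.ext e1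
        have s2 : σ ⟨2, by omega⟩ = ⟨1, by omega⟩ := Fin.ext e2
        simp only [Nat.reduceSub, s1, s2] at la lv l1 l0
        have c1 := (Link.iff_of_lt (lt_last 1 _ (by omega)) _ _).1 (l1 (a * 1))
        have ca := (Link.iff_of_gt (show (⟨1, by omega⟩ : Fin 4) < ⟨2, by omega⟩ from
          Fin.lt_def.2 (by simp)) _ _).1
          (la 1)
        have c0 := (Link.iff_of_lt (lt_last 0 _ (by omega)) _ _).1 (l0 1)
        simp only [stripConnection] at c1 ca c0
        simp at c1 ca c0
        rw [mul_inv_eq_iff_eq_mul] at c1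
        rw [c1] at c0
        rcases ca with ca | ca
        · exact ha (hinj0 (mul_inv_eq_one.1 ca)).symm
        · have hva' : v * q a * (q 1)⁻¹ = v * a⁻¹ := by
            have : a⁻¹ = q a * (q 1)⁻¹ :=
              inv_eq_iff_eq_inv.2 (by rw [mul_inv_rev, inv_inv]; exact ca.symm)
            rw [mul_assoc, ← this]
          rw [hva'] at c0
          rcases c0 with c0 | c0
          · exact hvaa (mul_inv_eq_iff_eq_mul.1 c0)
          · exact hbva c0.symm
      have h2 : τ 2 = 2 := by omega
      interval_cases i
      · exact h0
      · exact h1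
      · exact h2
      · exact hl
  simp only [hσ] at la lv l1
  have plast : p ⟨m - 1, hlm⟩ = q := by
    funext g
    have c := (Link.iff_of_lt (lt_last _ _ (by omega)) _ _).1 (l1 g)
    simp only [stripConnection] at c
    refine mul_inv_eq_one.1 ?_
    grind (splits := 20)
  rw [plast] at lv l0 l0'
  have hall : ∀ (g : G) (i : Fin m), f (g, i) = (q g, i) := by
    rintro g ⟨i, hi⟩
    rw [hf, hσ]
    by_cases h : i + 1 < m
    · rw [pcommon i hi h]
    · obtain rfl : i = m - 1 := by omega
      rw [plast]
  have ca : ∀ g, q (a * g) = a * q g := by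
    intro g
    have c := (Link.iff_of_lt (show (⟨1, by omega⟩ : Fin m) < ⟨m - 2, by omega⟩ from
      Fin.lt_def.2 (by simp; omega)) _ _).1 (la g)
    have hne := mt (qmul a g) ha
    simp only [stripConnection] at c
    refine mul_inv_eq_iff_eq_mul.1 ?_
    grind (splits := 20)
  have cv : ∀ g, q (v * g) = v * q g := by
    intro g
    have c := (Link.iff_of_lt (lt_last _ _ (by omega)) _ _).1 (lv g)
    simp only [stripConnection] at c
    refine mul_inv_eq_iff_eq_mul.1 ?_
    grind (splits := 20)
  have cb : ∀ g, q (b * g) = b * q g := by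
    intro g
    have c := (Link.iff_of_lt (lt_last _ _ (by omega)) _ _).1 (l0' g)
    have hne : q (b * g) * (q g)⁻¹ ≠ a := by
      intro h
      rw [mul_inv_eq_iff_eq_mul, ← ca] at h
      exact hba (mul_right_cancel (hinj0 h))
    simp only [stripConnection] at c
    refine mul_inv_eq_iff_eq_mul.1 ?_
    grind (splits := 20)
  refine ⟨q 1, ?_⟩
  rintro ⟨g, i⟩
  rw [hall, eq_mul_right_of_commute hgen (p := q) ?_ g]
  rintro x (rfl | rfl | rfl)
  exacts [ca, cv, cb]

end FourLayers

/-! ### Three layers, two generators -/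

section ThreeLayers

variable {G : Type*} [Group G] {x y a b : G}

/-- Connection sets for three layers and a group generated by `x` and `y`: the links
`g → x * g → y * x * g → x ^ 2 * y * x * g` run cyclically through the layers, and the links
labelled `1` form triangles. -/
def cyclicConnection (x y : G) (i j : ℕ) (s : G) : Prop :=
  (i = 0 ∧ j = 1 ∧ (s = 1 ∨ s = x)) ∨ (i = 1 ∧ j = 2 ∧ (s = 1 ∨ s = y)) ∨
    (i = 0 ∧ j = 2 ∧ (s = 1 ∨ s = (x * x)⁻¹))

/-- The label of the non-trivial links from layer `i` to layer `j` for `cyclicConnection x y`. -/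
def cyclicLabel (x y : G) : Fin 3 → Fin 3 → G :=
  ![![1, x, (x * x)⁻¹], ![x⁻¹, 1, y], ![x * x, y⁻¹, 1]]

theorem link_cyclicConnection_iff (g h : G) (i j : Fin 3) :
    Link (cyclicConnection x y) (g, i) (h, j) ↔ i ≠ j ∧ (h = g ∨ h = cyclicLabel x y i j * g) := by
  have e1 : ∀ s : G, g * h⁻¹ = s ↔ h = s⁻¹ * g := fun s => by
    rw [mul_inv_eq_iff_eq_mul, eq_inv_mul_iff_mul_eq, eq_comm]
  fin_cases i <;> fin_cases j <;>
    simp [Link, cyclicConnection, cyclicLabel, mul_inv_eq_iff_eq_mul, e1]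

theorem ncard_link_cyclicConnection (hx : x ≠ 1) (hxx : x * x ≠ 1) (hy : y ≠ 1) (i : Fin 3) :
    {u | Link (cyclicConnection x y) ((1 : G), i) u}.ncard = 4 := by
  have hset : ∀ j k : Fin 3, j ≠ i → k ≠ i → j ≠ k →
      {u | Link (cyclicConnection x y) ((1 : G), i) u} =
      {(1, j), (cyclicLabel x y i j, j), (1, k), (cyclicLabel x y i k, k)} := by
    intro j k hj hk hjk
    ext ⟨s, l⟩
    have hl : l = i ∨ l = j ∨ l = k := by omega
    simp only [Set.mem_ofPred_eq, link_cyclicConnection_iff, Set.mem_insert_iff,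
      Set.mem_singleton_iff, Prod.mk.injEq, mul_one]
    rcases hl with rfl | rfl | rfl <;> grind
  have hxx' : x⁻¹ * x⁻¹ ≠ 1 := by rwa [← mul_inv_rev, inv_ne_one]
  fin_cases i
  · rw [hset 1 2 (by decide) (by decide) (by decide)]
    apply ncard_insert_four <;> simp [cyclicLabel, *, eq_comm]
  · rw [hset 0 2 (by decide) (by decide) (by decide)]
    apply ncard_insert_four <;> simp [cyclicLabel, *, eq_comm]
  · rw [hset 0 1 (by decide) (by decide) (by decide)]
    apply ncard_insert_four <;> simp [cyclicLabel, *, eq_comm]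

theorem cyclicLabel_symm (i j : Fin 3) : cyclicLabel x y j i = (cyclicLabel x y i j)⁻¹ := by
  fin_cases i <;> fin_cases j <;> simp [cyclicLabel]

theorem cyclicLabel_ne_one (hx : x ≠ 1) (hxx : x * x ≠ 1) (hy : y ≠ 1) {i j : Fin 3}
    (hij : i ≠ j) : cyclicLabel x y i j ≠ 1 := by
  have hxx' : x⁻¹ * x⁻¹ ≠ 1 := by rwa [← mul_inv_rev, inv_ne_one]
  fin_cases i <;> fin_cases j <;> simp_all [cyclicLabel]

theorem cyclicLabel_mul_ne_one (hxxx : x * x * x ≠ 1) (hyx : y * x ≠ 1) (hxxy : x * x * y ≠ 1)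
    {i j k : Fin 3} (hij : i ≠ j) (hjk : j ≠ k) (hik : i ≠ k) :
    cyclicLabel x y j k * cyclicLabel x y i j ≠ 1 := by
  have h1 : x * y ≠ 1 := fun h => hyx (mul_eq_one_comm.1 h)
  have h2 : y * (x * x) ≠ 1 := fun h => hxxy (mul_eq_one_comm.1 h)
  have h3 : x * (x * x) ≠ 1 := fun h => hxxx (mul_eq_one_comm.1 h)
  have cyc : cyclicLabel x y 1 2 * cyclicLabel x y 0 1 ≠ 1 ∧
      cyclicLabel x y 2 0 * cyclicLabel x y 1 2 ≠ 1 ∧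
      cyclicLabel x y 0 1 * cyclicLabel x y 2 0 ≠ 1 := ⟨hyx, hxxy, h3⟩
  have rev : ∀ i j k, cyclicLabel x y j k * cyclicLabel x y i j ≠ 1 →
      cyclicLabel x y j i * cyclicLabel x y k j ≠ 1 := by
    intro i j k h h'
    rw [cyclicLabel_symm i j, cyclicLabel_symm j k, ← mul_inv_rev, inv_eq_one] at h'
    exact h h'
  have cases : (i = 0 ∧ j = 1 ∧ k = 2) ∨ (i = 1 ∧ j = 2 ∧ k = 0) ∨ (i = 2 ∧ j = 0 ∧ k = 1) ∨
      (i = 2 ∧ j = 1 ∧ k = 0) ∨ (i = 0 ∧ j = 2 ∧ k = 1) ∨ (i = 1 ∧ j = 0 ∧ k = 2) := by omega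
  rcases cases with ⟨rfl, rfl, rfl⟩ | ⟨rfl, rfl, rfl⟩ | ⟨rfl, rfl, rfl⟩ | ⟨rfl, rfl, rfl⟩ |
    ⟨rfl, rfl, rfl⟩ | ⟨rfl, rfl, rfl⟩
  exacts [cyc.1, cyc.2.1, cyc.2.2, rev _ _ _ cyc.1, rev _ _ _ cyc.2.1, rev _ _ _ cyc.2.2]

theorem cyclicLabel_mul_mul_ne_one (hxxyx : x * x * y * x ≠ 1) {i j k : Fin 3}
    (hij : i ≠ j) (hjk : j ≠ k) (hik : i ≠ k) :
    cyclicLabel x y k i * cyclicLabel x y j k * cyclicLabel x y i j ≠ 1 := by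
  have rot : ∀ i j k, cyclicLabel x y k i * cyclicLabel x y j k * cyclicLabel x y i j ≠ 1 →
      cyclicLabel x y i j * cyclicLabel x y k i * cyclicLabel x y j k ≠ 1 := by
    intro i j k h h'
    rw [mul_assoc] at h'
    exact h (mul_eq_one_comm.1 h')
  have rev : ∀ i j k, cyclicLabel x y k i * cyclicLabel x y j k * cyclicLabel x y i j ≠ 1 →
      cyclicLabel x y j i * cyclicLabel x y k j * cyclicLabel x y i k ≠ 1 := by
    intro i j k h h'
    rw [cyclicLabel_symm i j, cyclicLabel_symm j k, cyclicLabel_symm k i, ← mul_inv_rev,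
      ← mul_inv_rev, inv_eq_one, ← mul_assoc] at h'
    exact h h'
  have h0 : cyclicLabel x y 2 0 * cyclicLabel x y 1 2 * cyclicLabel x y 0 1 ≠ 1 := hxxyx
  have h1 := rot _ _ _ h0
  have h2 := rot _ _ _ h1
  have cases : (i = 0 ∧ j = 1 ∧ k = 2) ∨ (i = 1 ∧ j = 2 ∧ k = 0) ∨ (i = 2 ∧ j = 0 ∧ k = 1) ∨
      (i = 2 ∧ j = 1 ∧ k = 0) ∨ (i = 0 ∧ j = 2 ∧ k = 1) ∨ (i = 1 ∧ j = 0 ∧ k = 2) := by omega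
  rcases cases with ⟨rfl, rfl, rfl⟩ | ⟨rfl, rfl, rfl⟩ | ⟨rfl, rfl, rfl⟩ | ⟨rfl, rfl, rfl⟩ |
    ⟨rfl, rfl, rfl⟩ | ⟨rfl, rfl, rfl⟩
  exacts [h0, h1, h2, rev _ _ _ h2, rev _ _ _ h0, rev _ _ _ h1]

/-- The only triangles of links are those with labels `1`. -/
theorem triangle_cyclicConnection (hx : x ≠ 1) (hxx : x * x ≠ 1) (hxxx : x * x * x ≠ 1)
    (hy : y ≠ 1) (hyx : y * x ≠ 1) (hxxy : x * x * y ≠ 1) (hxxyx : x * x * y * x ≠ 1)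
    {i j k : Fin 3} {g h l : G} (h1 : Link (cyclicConnection x y) (g, i) (h, j))
    (h2 : Link (cyclicConnection x y) (h, j) (l, k))
    (h3 : Link (cyclicConnection x y) (l, k) (g, i)) : g = h ∧ h = l := by
  rw [link_cyclicConnection_iff] at h1 h2 h3
  obtain ⟨hij, h1⟩ := h1
  obtain ⟨hjk, h2⟩ := h2
  obtain ⟨hki, h3⟩ := h3
  have one : ∀ {i j : Fin 3}, i ≠ j → cyclicLabel x y i j ≠ 1 := cyclicLabel_ne_one hx hxx hy
  have two : ∀ {i j k : Fin 3}, i ≠ j → j ≠ k → i ≠ k →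
    cyclicLabel x y j k * cyclicLabel x y i j ≠ 1 := cyclicLabel_mul_ne_one hxxx hyx hxxy
  have three := cyclicLabel_mul_mul_ne_one hxxyx hij hjk hki.symm
  rcases h1 with rfl | rfl <;> rcases h2 with rfl | rfl
  · exact ⟨rfl, rfl⟩
  · rcases h3 with h3 | h3
    · exact absurd (by simpa using h3) (one hjk)
    · rw [← mul_assoc, eq_comm, mul_eq_right] at h3
      exact absurd h3 (two hjk hki hij.symm)
  · rcases h3 with h3 | h3
    · exact absurd (by simpa using h3) (one hij)
    · rw [← mul_assoc, eq_comm, mul_eq_right] at h3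
      exact absurd h3 (two hki hij hjk.symm ∘ fun h => mul_eq_one_comm.1 h)
  · rcases h3 with h3 | h3
    · rw [← mul_assoc, eq_comm, mul_eq_right] at h3
      exact absurd h3 (two hij hjk hki.symm)
    · rw [← mul_assoc, ← mul_assoc, eq_comm, mul_eq_right] at h3
      exact absurd h3 three

/-- The links with label `1` are recognized by the triangles, so an automorphism is given by one
permutation `q` of `G` and a permutation of the three layers; the latter permutes the labels
`x, y, x ^ 2` up to inversion, and the hypotheses exclude all non-trivial possibilities. -/
theorem hasHaarRepresentation_three_of_pair [Finite G] (hcard : 7 ≤ Nat.card G)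
    (hxx : x * x ≠ 1) (hxxx : x * x * x ≠ 1)
    (hy : y ≠ 1) (hyx : y * x ≠ 1) (hxxy : x * x * y ≠ 1) (hxxyx : x * x * y * x ≠ 1)
    (hyxx : y ≠ x * x) (hyyx : y * y ≠ x) (hyyxx : y * y ≠ x * x)
    (hgen : Subgroup.closure {x, y} = ⊤) : HasHaarRepresentation 3 G := by
  have hx : x ≠ 1 := by rintro rfl; simp at hxx
  have hD := fun i => ncard_link_cyclicConnection (G := G) hx hxx hy i
  refine hasHaarRepresentation_of_rigid (P := cyclicConnection x y) (by omega) 4 hD ?_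
  intro f
  have hP : ∀ i j, i < j → j < 3 →
      ∃ T : Finset G, T.card ≤ 2 ∧ ∀ r, cyclicConnection x y i j r → r ∈ T := by
    classical
    intro i j hij hj
    by_cases h0 : i = 0
    · by_cases h1 : j = 1
      · exact ⟨{1, x}, Finset.card_le_two, fun r hr => by simp [cyclicConnection] at *; grind⟩
      · exact ⟨{1, (x * x)⁻¹}, Finset.card_le_two, fun r hr => by
          simp [cyclicConnection] at *; grind⟩
    · exact ⟨{1, y}, Finset.card_le_two, fun r hr => by simp [cyclicConnection] at *; grind⟩
  obtain ⟨p, σ, hf, hp, hlink⟩ := exists_layer_perm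
    (layer_of_link_le hcard (fun i => (hD i).le) hP) f
  have hone : ∀ i j : Fin 3, i ≠ j → ∀ g, Link (cyclicConnection x y) (p i g, σ i) (p j g, σ j) :=
    fun i j hij g => hlink _ _ _ _ ((link_cyclicConnection_iff _ _ _ _).2 ⟨hij, .inl rfl⟩)
  have htri : ∀ g, p 0 g = p 1 g ∧ p 1 g = p 2 g := fun g =>
    triangle_cyclicConnection hx hxx hxxx hy hyx hxxy hxxyx (hone 0 1 (by decide) g)
      (hone 1 2 (by decide) g) (hone 2 0 (by decide) g)
  have hq : ∀ i, p i = p 0 := by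
    intro i
    funext g
    fin_cases i
    · rfl
    · exact (htri g).1.symm
    · exact ((htri g).1.trans (htri g).2).symm
  set q := p 0
  have hqi : Function.Injective q := hp 0
  have hlabel : ∀ i j : Fin 3, i ≠ j → ∀ g,
      q (cyclicLabel x y i j * g) = cyclicLabel x y (σ i) (σ j) * q g := by
    intro i j hij g
    have h := hlink g (cyclicLabel x y i j * g) i j
      ((link_cyclicConnection_iff _ _ _ _).2 ⟨hij, .inr rfl⟩)
    rw [link_cyclicConnection_iff, hq i, hq j] at h
    refine h.2.resolve_left fun h' => ?_
    have := hqi h'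
    rw [mul_eq_right] at this
    exact cyclicLabel_ne_one hx hxx hy hij this
  have lx := hlabel 0 1 (by decide)
  have ly := hlabel 1 2 (by decide)
  have lz := hlabel 2 0 (by decide)
  have h01 : σ 0 ≠ σ 1 := by simp
  have h12 : σ 1 ≠ σ 2 := by simp
  have h02 : σ 0 ≠ σ 2 := by simp
  have cases : (σ 0 = 0 ∧ σ 1 = 1 ∧ σ 2 = 2) ∨ (σ 0 = 1 ∧ σ 1 = 2 ∧ σ 2 = 0) ∨
      (σ 0 = 2 ∧ σ 1 = 0 ∧ σ 2 = 1) ∨ (σ 0 = 2 ∧ σ 1 = 1 ∧ σ 2 = 0) ∨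
      (σ 0 = 0 ∧ σ 1 = 2 ∧ σ 2 = 1) ∨ (σ 0 = 1 ∧ σ 1 = 0 ∧ σ 2 = 2) := by omega
  have assoc : ∀ g, q (x * x * g) = q (x * (x * g)) := fun g => by rw [mul_assoc]
  rcases cases with ⟨e0, e1, e2⟩ | ⟨e0, e1, e2⟩ | ⟨e0, e1, e2⟩ | ⟨e0, e1, e2⟩ | ⟨e0, e1, e2⟩ |
    ⟨e0, e1, e2⟩ <;> simp [cyclicLabel, e0, e1, e2] at lx ly lz
  · refine ⟨q 1, ?_⟩
    rintro ⟨g, i⟩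
    have hσ : σ i = i := by fin_cases i <;> assumption
    rw [hf, hσ, hq, eq_mul_right_of_commute hgen (p := q) ?_ g]
    rintro s (rfl | rfl)
    exacts [lx, ly]
  · -- `x ↦ y ↦ x ^ 2 ↦ x`
    have := lz 1
    rw [assoc, lx, lx, ← mul_assoc, mul_left_inj] at this
    exact absurd this hyyx
  · -- `x ↦ x ^ 2 ↦ y ↦ x`
    have h1 := lz 1
    rw [assoc, lx, lx, ← mul_assoc, mul_left_inj] at h1
    have h2 := ly 1
    rw [← h1, mul_assoc, assoc, lx, lx, assoc, lx, lx] at h2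
    simp only [← mul_assoc, mul_left_inj] at h2
    refine absurd ?_ hyyx
    rw [← h1]
    simpa only [mul_assoc] using h2
  · -- `x ↦ y⁻¹` and `x ^ 2 ↦ x ^ (-2)`
    have := lz 1
    rw [assoc, lx, lx] at this
    simp only [← mul_assoc, mul_left_inj, ← mul_inv_rev] at this
    exact absurd (inv_injective this) hyyxx
  · -- `x ↦ x ^ (-2)` and `x ^ 2 ↦ x⁻¹`
    have := lz 1
    rw [assoc, lx, lx] at this
    simp only [← mul_assoc, mul_left_inj, ← mul_inv_rev] at this
    have := inv_injective this
    rw [mul_eq_right] at this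
    exact absurd this hxxx
  · -- `x ↦ x⁻¹` and `x ^ 2 ↦ y⁻¹`
    have := lz 1
    rw [assoc, lx, lx] at this
    simp only [← mul_assoc, mul_left_inj, ← mul_inv_rev] at this
    exact absurd (inv_injective this).symm hyxx

end ThreeLayers

/-! ### Three layers, four labels -/

section FourLabels

variable {G : Type*} [Group G] {a b x y : G}

/-- Connection sets for three layers with three links from each vertex to each other layer. The
labels are chosen such that the triangles of links through the layers `0, 1, 2` are exactly
`g, g, g`, `g, g, b * g` and `g, a * g, a * g`. -/
def tripleConnection (a b x y : G) (i j : ℕ) (s : G) : Prop :=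
  (i = 0 ∧ j = 1 ∧ (s = 1 ∨ s = a ∨ s = x)) ∨ (i = 1 ∧ j = 2 ∧ (s = 1 ∨ s = b ∨ s = y)) ∨
    (i = 0 ∧ j = 2 ∧ (s = 1 ∨ s = a ∨ s = b))

/-- The non-degeneracy conditions under which `tripleConnection a b x y` has no further
triangles, and every vertex has six links. -/
structure TripleLabels (a b x y : G) : Prop where
  ha : a ≠ 1
  hb : b ≠ 1
  hab : a ≠ b
  hba : b * a ≠ 1
  hx : x ≠ 1
  hxa : x ≠ a
  hxb : x ≠ b
  hbx : b * x ≠ 1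
  hbxa : b * x ≠ a
  hy : y ≠ 1
  hyb : y ≠ b
  hya : y ≠ a
  hya' : y * a ≠ 1
  hyab : y * a ≠ b
  hyx : y * x ≠ 1
  hyxa : y * x ≠ a
  hyxb : y * x ≠ b

theorem link_triple_zero_one (g h : G) : Link (m := 3) (tripleConnection a b x y) (g, 0) (h, 1) ↔
    h = g ∨ h = a * g ∨ h = x * g := by
  simp [Link, tripleConnection, mul_inv_eq_iff_eq_mul]

theorem link_triple_one_two (g h : G) : Link (m := 3) (tripleConnection a b x y) (g, 1) (h, 2) ↔
    h = g ∨ h = b * g ∨ h = y * g := by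
  simp [Link, tripleConnection, mul_inv_eq_iff_eq_mul]

theorem link_triple_zero_two (g h : G) : Link (m := 3) (tripleConnection a b x y) (g, 0) (h, 2) ↔
    h = g ∨ h = a * g ∨ h = b * g := by
  simp [Link, tripleConnection, mul_inv_eq_iff_eq_mul]

theorem triangle_tripleConnection (hl : TripleLabels a b x y) {g h l : G}
    (h1 : Link (m := 3) (tripleConnection a b x y) (g, 0) (h, 1))
    (h2 : Link (m := 3) (tripleConnection a b x y) (h, 1) (l, 2))
    (h3 : Link (m := 3) (tripleConnection a b x y) (g, 0) (l, 2)) :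
    (h = g ∧ l = g) ∨ (h = g ∧ l = b * g) ∨ (h = a * g ∧ l = a * g) := by
  obtain ⟨ha, hb, hab, hba, hx, hxa, hxb, hbx, hbxa, hy, hyb, hya, hya', hyab, hyx, hyxa, hyxb⟩ :=
    hl
  rw [link_triple_zero_one] at h1
  rw [link_triple_one_two] at h2
  rw [link_triple_zero_two] at h3
  rcases h1 with rfl | rfl | rfl <;> rcases h2 with rfl | rfl | rfl <;>
    simp only [← mul_assoc, mul_left_inj, mul_eq_right, mul_eq_left] at h3 ⊢ <;>
    grind (splits := 20)

/-- A set of eight or more vertices in which any two vertices of different layers are linked lies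
in one layer: if it meets the layers `0` and `2`, then it has at most three vertices in each of
them, and only one in layer `1`, since the link between layers `0` and `2` lies on at
most one triangle. -/
theorem layer_of_tripleConnection [Finite G] (hl : TripleLabels a b x y) (hcard : 8 ≤ Nat.card G)
    (q : G → G × Fin 3) (hq : Function.Injective q)
    (hlink : ∀ g h, (q g).2 ≠ (q h).2 → Link (tripleConnection a b x y) (q g) (q h)) (g h : G) :
    (q g).2 = (q h).2 := by
  have hP : ∀ i j, i < j → j < 3 →
      ∃ T : Finset G, T.card ≤ 3 ∧ ∀ r, tripleConnection a b x y i j r → r ∈ T := by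
    classical
    intro i j hij hj
    by_cases h0 : i = 0
    · by_cases h1 : j = 1
      · exact ⟨{1, a, x}, Finset.card_le_three, fun r hr => by
          simp [tripleConnection] at *; grind⟩
      · exact ⟨{1, a, b}, Finset.card_le_three, fun r hr => by
          simp [tripleConnection] at *; grind⟩
    · exact ⟨{1, b, y}, Finset.card_le_three, fun r hr => by simp [tripleConnection] at *; grind⟩
  have hr : (Set.range q).ncard = Nat.card G := by
    rw [← Set.image_univ, Set.ncard_image_of_injective _ hq, Set.ncard_univ]
  -- the layers `0` and `2` are not both met
  have h02 : ∀ g h, (q g).2 = 0 → (q h).2 ≠ 2 := by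
    intro g h hg hh
    have hsub : Set.range q ⊆ ({w | w.2 = 0 ∧ Link (tripleConnection a b x y) (q h) w} ∪
        {w | w.2 = 2 ∧ Link (tripleConnection a b x y) (q g) w}) ∪
        {w | w.2 = 1 ∧ Link (tripleConnection a b x y) (q g) w ∧
          Link (tripleConnection a b x y) w (q h)} := by
      rintro _ ⟨k, rfl⟩
      have hk : (q k).2 = 0 ∨ (q k).2 = 2 ∨ (q k).2 = 1 := by omega
      rcases hk with hk | hk | hk
      · exact .inl (.inl ⟨hk, hlink _ _ (by simp [hk, hh])⟩)
      · exact .inl (.inr ⟨hk, hlink _ _ (by simp [hk, hg])⟩)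
      · exact .inr ⟨hk, hlink _ _ (by simp [hk, hg]), hlink _ _ (by simp [hk, hh])⟩
    have hone : {w | w.2 = 1 ∧ Link (tripleConnection a b x y) (q g) w ∧
        Link (tripleConnection a b x y) w (q h)}.ncard ≤ 1 := by
      refine (Set.ncard_le_one_iff (Set.toFinite _)).2 ?_
      rintro ⟨w, _⟩ ⟨w', _⟩ ⟨rfl, h1, h2⟩ ⟨rfl, h1', h2'⟩
      have hgh := hlink g h (by simp [hg, hh])
      rw [show q g = ((q g).1, 0) from Prod.ext rfl hg] at h1 h1' hgh
      rw [show q h = ((q h).1, 2) from Prod.ext rfl hh] at h2 h2' hgh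
      have t := triangle_tripleConnection hl h1 h2 hgh
      have t' := triangle_tripleConnection hl h1' h2' hgh
      obtain ⟨ha, hb, hab, -⟩ := hl
      have e1 : ∀ s t z : G, s * z = t * z ↔ s = t := fun s t z => mul_left_inj z
      have e2 : ∀ s z : G, s * z = z ↔ s = 1 := fun s z => mul_eq_right
      grind (splits := 20)
    have := Set.ncard_le_ncard hsub
    have := Set.ncard_union_le ({w | w.2 = 0 ∧ Link (tripleConnection a b x y) (q h) w} ∪
        {w | w.2 = 2 ∧ Link (tripleConnection a b x y) (q g) w})
        {w | w.2 = 1 ∧ Link (tripleConnection a b x y) (q g) w ∧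
          Link (tripleConnection a b x y) w (q h)}
    have := Set.ncard_union_le {w | w.2 = 0 ∧ Link (tripleConnection a b x y) (q h) w}
        {w | w.2 = 2 ∧ Link (tripleConnection a b x y) (q g) w}
    have := ncard_link_layer_le hP (q h) 0
    have := ncard_link_layer_le hP (q g) 2
    omega
  by_contra hne
  have hsub : Set.range q ⊆ {w | w.2 = (q g).2 ∧ Link (tripleConnection a b x y) (q h) w} ∪
      {w | w.2 = (q h).2 ∧ Link (tripleConnection a b x y) (q g) w} := by
    rintro _ ⟨k, rfl⟩
    by_cases hk : (q k).2 = (q g).2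
    · exact .inl ⟨hk, hlink _ _ (hk ▸ Ne.symm hne)⟩
    · refine .inr ⟨?_, hlink _ _ (Ne.symm hk)⟩
      have := h02 g h
      have := h02 g k
      have := h02 h g
      have := h02 h k
      have := h02 k g
      have := h02 k h
      omega
  have := Set.ncard_le_ncard hsub
  have := Set.ncard_union_le {w | w.2 = (q g).2 ∧ Link (tripleConnection a b x y) (q h) w}
    {w | w.2 = (q h).2 ∧ Link (tripleConnection a b x y) (q g) w}
  have := ncard_link_layer_le hP (q h) (q g).2
  have := ncard_link_layer_le hP (q g) (q h).2
  omega

theorem ncard_insert_six {α : Type*} {u v w x y z : α} (h1 : u ∉ ({v, w, x, y, z} : Set α))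
    (h2 : v ∉ ({w, x, y, z} : Set α)) (h3 : w ∉ ({x, y, z} : Set α)) (h4 : x ∉ ({y, z} : Set α))
    (h5 : y ≠ z) : ({u, v, w, x, y, z} : Set α).ncard = 6 := by
  rw [Set.ncard_insert_of_notMem h1, Set.ncard_insert_of_notMem h2, Set.ncard_insert_of_notMem h3,
    Set.ncard_insert_of_notMem h4, Set.ncard_pair h5]

theorem ncard_link_tripleConnection (hl : TripleLabels a b x y) (i : Fin 3) :
    {u | Link (tripleConnection a b x y) ((1 : G), i) u}.ncard = 6 := by
  obtain ⟨ha, hb, hab, hba, hx, hxa, hxb, hbx, hbxa, hy, hyb, hya, hya', hyab, hyx, hyxa, hyxb⟩ :=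
    hl
  have hinv : ∀ s t : G, s⁻¹ = t ↔ s = t⁻¹ := fun s t => inv_eq_iff_eq_inv
  fin_cases i
  · have : {u | Link (tripleConnection a b x y) ((1 : G), (0 : Fin 3)) u} =
        {(1, 1), (a, 1), (x, 1), (1, 2), (a, 2), (b, 2)} := by
      ext ⟨s, j⟩
      fin_cases j <;> simp [Link, tripleConnection]
    refine (congrArg _ this).trans (ncard_insert_six ?_ ?_ ?_ ?_ ?_) <;>
      simp [*, eq_comm] <;> grind
  · have : {u | Link (tripleConnection a b x y) ((1 : G), (1 : Fin 3)) u} =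
        {(1, 0), (a⁻¹, 0), (x⁻¹, 0), (1, 2), (b, 2), (y, 2)} := by
      ext ⟨s, j⟩
      fin_cases j <;> simp [Link, tripleConnection, hinv]
    refine (congrArg _ this).trans (ncard_insert_six ?_ ?_ ?_ ?_ ?_) <;>
      simp [*, eq_comm] <;> grind
  · have : {u | Link (tripleConnection a b x y) ((1 : G), (2 : Fin 3)) u} =
        {(1, 1), (b⁻¹, 1), (y⁻¹, 1), (1, 0), (a⁻¹, 0), (b⁻¹, 0)} := by
      ext ⟨s, j⟩
      fin_cases j <;> simp [Link, tripleConnection, hinv]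
    refine (congrArg _ this).trans (ncard_insert_six ?_ ?_ ?_ ?_ ?_) <;>
      simp [*, eq_comm] <;> grind

/-- The links on two triangles are those with label `1` between layer `1` and another layer. This
determines the layer `1` and identifies the three layers with each other, and the remaining
triangles yield the labels `a` and `b`. The only symmetry left is the exchange of the layers `0`
and `2`, which `hflip` excludes. -/
theorem hasHaarRepresentation_three_of_labels [Finite G] (hl : TripleLabels a b x y)
    (hcard : 8 ≤ Nat.card G) (hgen : Subgroup.closure {a, b, x, y} = ⊤)
    (hflip : ∀ q : G → G, (∀ g, q (a * g) = b⁻¹ * q g) → (∀ g, q (b * g) = a⁻¹ * q g) →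
      (∀ g, q (x * g) = y⁻¹ * q g) → (∀ g, q (y * g) = x⁻¹ * q g) → False) :
    HasHaarRepresentation 3 G := by
  have hD := fun i => ncard_link_tripleConnection hl i
  refine hasHaarRepresentation_of_rigid (P := tripleConnection a b x y) (by omega) 6 hD ?_
  intro f
  obtain ⟨p, σ, hf, hp, hlink⟩ := exists_layer_perm
    (layer_of_tripleConnection hl hcard) f
  have triangle : ∀ {g h l : G}, Link (m := 3) (tripleConnection a b x y) (g, 0) (h, 1) →
    Link (m := 3) (tripleConnection a b x y) (h, 1) (l, 2) →
    Link (m := 3) (tripleConnection a b x y) (g, 0) (l, 2) →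
    (h = g ∧ l = g) ∨ (h = g ∧ l = b * g) ∨ (h = a * g ∧ l = a * g) :=
    triangle_tripleConnection hl
  obtain ⟨ha, hb, hab, hba, hx, hxa, hxb, hbx, hbxa, hy, hyb, hya, hya', hyab, hyx, hyxa, hyxb⟩ :=
    hl
  -- images of the links
  have k01 := fun g => hlink g g 0 1 ((link_triple_zero_one _ _).2 (.inl rfl))
  have k01a := fun g => hlink g (a * g) 0 1 ((link_triple_zero_one _ _).2 (.inr (.inl rfl)))
  have k01x := fun g => hlink g (x * g) 0 1 ((link_triple_zero_one _ _).2 (.inr (.inr rfl)))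
  have k12 := fun g => hlink g g 1 2 ((link_triple_one_two _ _).2 (.inl rfl))
  have k12b := fun g => hlink g (b * g) 1 2 ((link_triple_one_two _ _).2 (.inr (.inl rfl)))
  have k12y := fun g => hlink g (y * g) 1 2 ((link_triple_one_two _ _).2 (.inr (.inr rfl)))
  have k02 := fun g => hlink g g 0 2 ((link_triple_zero_two _ _).2 (.inl rfl))
  have k02a := fun g => hlink g (a * g) 0 2 ((link_triple_zero_two _ _).2 (.inr (.inl rfl)))
  have k02b := fun g => hlink g (b * g) 0 2 ((link_triple_zero_two _ _).2 (.inr (.inr rfl)))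
  have k01a' := fun g => k01a (a⁻¹ * g)
  have k02a' := fun g => k02a (a⁻¹ * g)
  simp only [mul_inv_cancel_left] at k01a' k02a'
  have nb : ∀ i g, p i (b * g) ≠ p i g := fun i g h => hb (mul_eq_right.1 (hp i h))
  have na : ∀ i g, p i (a * g) ≠ p i g := fun i g h => ha (mul_eq_right.1 (hp i h))
  have na' : ∀ i g, p i (a⁻¹ * g) ≠ p i g := fun i g h => ha (by simpa using hp i h)
  -- a link between the layers `0` and `2` lies on at most one triangle
  have unique : ∀ {g l h h' : G}, Link (m := 3) (tripleConnection a b x y) (g, 0) (l, 2) →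
      Link (m := 3) (tripleConnection a b x y) (g, 0) (h, 1) →
      Link (m := 3) (tripleConnection a b x y) (h, 1) (l, 2) →
      Link (m := 3) (tripleConnection a b x y) (g, 0) (h', 1) →
      Link (m := 3) (tripleConnection a b x y) (h', 1) (l, 2) → h = h' := by
    intro g l h h' h1 h2 h3 h4 h5
    have t := triangle h2 h3 h1
    have t' := triangle h4 h5 h1
    have e1 : ∀ s t z : G, s * z = t * z ↔ s = t := fun s t z => mul_left_inj z
    have e2 : ∀ s z : G, s * z = z ↔ s = 1 := fun s z => mul_eq_right
    grind (splits := 20)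
  have cases : (σ 0 = 0 ∧ σ 1 = 1 ∧ σ 2 = 2) ∨ (σ 0 = 1 ∧ σ 1 = 2 ∧ σ 2 = 0) ∨
      (σ 0 = 2 ∧ σ 1 = 0 ∧ σ 2 = 1) ∨ (σ 0 = 2 ∧ σ 1 = 1 ∧ σ 2 = 0) ∨
      (σ 0 = 0 ∧ σ 1 = 2 ∧ σ 2 = 1) ∨ (σ 0 = 1 ∧ σ 1 = 0 ∧ σ 2 = 2) := by
    have h01 : σ 0 ≠ σ 1 := by simp
    have h12 : σ 1 ≠ σ 2 := by simp
    have h02 : σ 0 ≠ σ 2 := by simp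
    omega
  rcases cases with ⟨e0, e1, e2⟩ | ⟨e0, e1, e2⟩ | ⟨e0, e1, e2⟩ | ⟨e0, e1, e2⟩ | ⟨e0, e1, e2⟩ |
    ⟨e0, e1, e2⟩ <;>
    simp only [e0, e1, e2] at k01 k01a k01a' k01x k12 k12b k12y k02 k02a k02a' k02b
  · have h10 : ∀ g, p 1 g = p 0 g := by
      intro g
      have t := triangle (k01 g) (k12 g) (k02 g)
      have t' := triangle (k01 g) (k12b g) (k02b g)
      have := nb 2 g
      grind
    have h21 : ∀ g, p 2 g = p 1 g := by
      intro g
      have t := triangle (k01 g) (k12 g) (k02 g)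
      have t' := triangle (k01a' g) (k12 g) (k02a' g)
      have := na' 0 g
      have e1 : ∀ s t z : G, s * z = t * z ↔ s = t := fun s t z => mul_left_inj z
      grind
    have hq : ∀ i, p i = p 0 := by
      intro i
      funext g
      fin_cases i
      · rfl
      · exact h10 g
      · exact (h21 g).trans (h10 g)
    simp only [hq 1, hq 2] at k01 k01a k01x k12 k12b k12y k02 k02a k02b
    set q := p 0
    have ca : ∀ g, q (a * g) = a * q g := by
      intro g
      have t := triangle (k01a g) (k12 (a * g)) (k02a g)
      have := na 0 g
      grind
    have cb : ∀ g, q (b * g) = b * q g := by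
      intro g
      have t := triangle (k01 g) (k12b g) (k02b g)
      have := nb 0 g
      have e2 : a * q g ≠ q g := fun h => ha (mul_eq_right.1 h)
      grind
    have cx : ∀ g, q (x * g) = x * q g := by
      intro g
      have t := (link_triple_zero_one _ _).1 (k01x g)
      rw [← ca] at t
      rcases t with t | t | t
      · exact absurd (mul_eq_right.1 (hp 0 t)) hx
      · exact absurd (mul_right_cancel (hp 0 t)) hxa
      · exact t
    have cy : ∀ g, q (y * g) = y * q g := by
      intro g
      have t := (link_triple_one_two _ _).1 (k12y g)
      rw [← cb] at t
      rcases t with t | t | t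
      · exact absurd (mul_eq_right.1 (hp 0 t)) hy
      · exact absurd (mul_right_cancel (hp 0 t)) hyb
      · exact t
    refine ⟨q 1, ?_⟩
    rintro ⟨g, i⟩
    have hσ : σ i = i := by fin_cases i <;> assumption
    rw [hf, hσ, hq, eq_mul_right_of_commute hgen (p := q) ?_ g]
    rintro s (rfl | rfl | rfl | rfl)
    exacts [ca, cb, cx, cy]
  · exact absurd (unique (k12 1).symm (k02 1).symm (k01 1) (k02a' 1).symm (k01a' 1)).symm
      (na' 0 1)
  · exact absurd (unique (k01 1).symm (k12 1) (k02 1).symm (k12b 1) (k02b 1).symm).symm (nb 2 1)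
  · exfalso
    have h10 : ∀ g, p 1 g = p 0 g := by
      intro g
      have t := triangle (k12 g).symm (k01 g).symm (k02 g).symm
      have t' := triangle (k12b g).symm (k01 g).symm (k02b g).symm
      have := nb 2 g
      have e1 : ∀ s t z : G, s * z = t * z ↔ s = t := fun s t z => mul_left_inj z
      grind
    have h21 : ∀ g, p 2 g = p 1 g := by
      intro g
      have t := triangle (k12 g).symm (k01 g).symm (k02 g).symm
      have t' := triangle (k12 g).symm (k01a' g).symm (k02a' g).symm
      have := na' 0 g
      grind
    have hq : ∀ i, p i = p 0 := by
      intro i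
      funext g
      fin_cases i
      · rfl
      · exact h10 g
      · exact (h21 g).trans (h10 g)
    simp only [hq 1, hq 2] at k01 k01a k01x k12 k12b k12y k02 k02a k02b
    set q := p 0
    have ca : ∀ g, q g = b * q (a * g) := by
      intro g
      have t := triangle (k12 (a * g)).symm (k01a g).symm (k02a g).symm
      have := na 0 g
      have e2 : a * q (a * g) ≠ q (a * g) := fun h => ha (mul_eq_right.1 h)
      grind
    have cb : ∀ g, q g = a * q (b * g) := by
      intro g
      have t := triangle (k12b g).symm (k01 g).symm (k02b g).symm
      have := nb 0 g
      grind
    have cx : ∀ g, q g = y * q (x * g) := by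
      intro g
      have t := (link_triple_one_two _ _).1 (k01x g).symm
      rcases t with t | t | t
      · exact absurd (mul_eq_right.1 (hp 0 t).symm) hx
      · rw [ca] at t
        exact absurd (mul_right_cancel (hp 0 (mul_left_cancel t))).symm hxa
      · exact t
    have cy : ∀ g, q g = x * q (y * g) := by
      intro g
      have t := (link_triple_zero_one _ _).1 (k12y g).symm
      rcases t with t | t | t
      · exact absurd (mul_eq_right.1 (hp 0 t).symm) hy
      · rw [cb] at t
        exact absurd (mul_right_cancel (hp 0 (mul_left_cancel t))).symm hyb
      · exact t
    exact hflip q (fun g => eq_inv_mul_of_mul_eq (ca g).symm)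
      (fun g => eq_inv_mul_of_mul_eq (cb g).symm) (fun g => eq_inv_mul_of_mul_eq (cx g).symm)
      fun g => eq_inv_mul_of_mul_eq (cy g).symm
  · exact absurd (unique (k01 1) (k02 1) (k12 1).symm (k02b 1) (k12b 1).symm).symm (nb 2 1)
  · exact absurd (unique (k12 1) (k01 1).symm (k02 1) (k01a' 1).symm (k02a' 1)).symm (na' 0 1)

end FourLabels

/-! ### Recognizing the excluded groups -/

section SmallGroups

variable {G : Type*} [Group G] {x y : G}

theorem isCyclic_of_closure_pair {z : G} (h : Subgroup.closure {x, y} = ⊤)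
    (hx : x ∈ Subgroup.zpowers z) (hy : y ∈ Subgroup.zpowers z) : IsCyclic G := by
  rw [isCyclic_iff_exists_zpowers_eq_top]
  refine ⟨z, eq_top_iff.2 (h ▸ (Subgroup.closure_le _).2 ?_)⟩
  rintro _ (rfl | rfl)
  exacts [hx, hy]

theorem closure_pair_eq_top {x' y' : G} (h : Subgroup.closure {x, y} = ⊤)
    (hx : x ∈ Subgroup.closure {x', y'}) (hy : y ∈ Subgroup.closure {x', y'}) :
    Subgroup.closure {x', y'} = ⊤ := by
  refine eq_top_iff.2 (h ▸ (Subgroup.closure_le _).2 ?_)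
  rintro _ (rfl | rfl)
  exacts [hx, hy]

theorem closure_swap (h : Subgroup.closure {x, y} = ⊤) : Subgroup.closure {y, x} = ⊤ := by
  rwa [Set.pair_comm]

theorem closure_pair_mul (h : Subgroup.closure {x, y} = ⊤) :
    Subgroup.closure {x, y * x} = ⊤ := by
  have hx : x ∈ Subgroup.closure {x, y * x} := Subgroup.subset_closure (by simp)
  have hyx : y * x ∈ Subgroup.closure {x, y * x} := Subgroup.subset_closure (by simp)
  refine closure_pair_eq_top h hx ?_
  simpa using mul_mem hyx (inv_mem hx)

theorem mul_comm_of_closure {S : Set G} (hS : Subgroup.closure S = ⊤)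
    (hcomm : ∀ s ∈ S, ∀ t ∈ S, s * t = t * s) (g h : G) : g * h = h * g := by
  have := Subgroup.isMulCommutative_closure hcomm
  have := this.is_comm.comm ⟨g, hS ▸ Subgroup.mem_top g⟩ ⟨h, hS ▸ Subgroup.mem_top h⟩
  exact congrArg Subtype.val this

theorem inSmallGroups_of_isCyclic [Finite G] (hG : IsCyclic G) (hcard : Nat.card G ≤ 6) :
    InSmallGroups G :=
  .inl ⟨Nat.card G, Nat.card_pos, hcard, ⟨(zmodCyclicMulEquiv hG).symm⟩⟩

theorem exists_addEquiv_of_zmod_module {A : Type*} [AddCommGroup A] [Finite A] {p : ℕ}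
    [Fact p.Prime] [Module (ZMod p) A] (S : Finset A)
    (hS : AddSubgroup.closure (S : Set A) = ⊤) :
    ∃ d ≤ S.card, Nonempty (A ≃+ (Fin d → ZMod p)) := by
  have : Module.Finite (ZMod p) A := Module.Finite.of_finite
  have hspan : Submodule.span (ZMod p) (S : Set A) = ⊤ := by
    have h : AddSubgroup.closure (S : Set A) ≤
        (Submodule.span (ZMod p) (S : Set A)).toAddSubgroup :=
      (AddSubgroup.closure_le _).2 Submodule.subset_span
    rw [hS, top_le_iff] at h
    exact Submodule.toAddSubgroup_injective h
  refine ⟨Module.finrank (ZMod p) A, ?_, ⟨(Module.finBasis (ZMod p) A).equivFun.toAddEquiv⟩⟩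
  have := finrank_span_finset_le_card (R := ZMod p) S
  rwa [Set.finrank, hspan, finrank_top] at this

/-- A finite commutative group of prime exponent `p` generated by `S` is a power of the cyclic group
of order `p`, with at most `|S|` factors. -/
theorem exists_mulEquiv_of_exponent_prime [Finite G] {p : ℕ} [Fact p.Prime]
    (hcomm : ∀ g h : G, g * h = h * g) (hp : ∀ g : G, g ^ p = 1) (S : Finset G)
    (hS : Subgroup.closure (S : Set G) = ⊤) :
    ∃ d ≤ S.card, Nonempty (G ≃* (Fin d → Multiplicative (ZMod p))) := by
  let : CommGroup G := { ‹Group G› with mul_comm := hcomm }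
  let : Module (ZMod p) (Additive G) :=
    AddCommGroup.zmodModule fun g => congrArg Additive.ofMul (hp g.toMul)
  have hS' : AddSubgroup.closure ((S.map Additive.ofMul.toEmbedding : Finset (Additive G)) :
      Set (Additive G)) = ⊤ := by
    have := congrArg Subgroup.toAddSubgroup hS
    rw [Subgroup.toAddSubgroup_closure] at this
    convert this using 2
    · ext g
      simp
    · rfl
  obtain ⟨d, hd, ⟨e⟩⟩ := exists_addEquiv_of_zmod_module (p := p) _ hS'
  exact ⟨d, by simpa using hd, ⟨AddEquiv.toMultiplicative e⟩⟩

theorem inSmallGroups_of_sq_eq_one [Finite G] (hsq : ∀ g : G, g * g = 1) (S : Finset G)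
    (hS : Subgroup.closure (S : Set G) = ⊤) (hcard : S.card ≤ 3) : InSmallGroups G := by
  have hcomm : ∀ g h : G, g * h = h * g := by
    intro g h
    have e : ∀ g : G, g⁻¹ = g := fun g => inv_eq_of_mul_eq_one_left (hsq g)
    rw [← e (g * h), mul_inv_rev, e, e]
  obtain ⟨d, hd, ⟨e⟩⟩ := exists_mulEquiv_of_exponent_prime (p := 2) hcomm
    (fun g => by rw [pow_two, hsq]) S hS
  have : d ≤ 3 := hd.trans hcard
  interval_cases d
  · exact .inl ⟨1, le_rfl, by norm_num, ⟨e.trans MulEquiv.ofUnique⟩⟩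
  · exact .inl ⟨2, by norm_num, by norm_num, ⟨e.trans (MulEquiv.funUnique _ _)⟩⟩
  · exact .inr (.inl ⟨e⟩)
  · exact .inr (.inr (.inl ⟨e⟩))

theorem inSmallGroups_of_comm_of_cube_eq_one [Finite G] (hcomm : ∀ g h : G, g * h = h * g)
    (hcube : ∀ g : G, g ^ 3 = 1) (hgen : Subgroup.closure {x, y} = ⊤) : InSmallGroups G := by
  classical
  obtain ⟨d, hd, ⟨e⟩⟩ := exists_mulEquiv_of_exponent_prime (p := 3) hcomm hcube {x, y}
    (by simpa using hgen)
  have : d ≤ 2 := hd.trans Finset.card_le_two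
  interval_cases d
  · exact .inl ⟨1, le_rfl, by norm_num, ⟨e.trans MulEquiv.ofUnique⟩⟩
  · exact .inl ⟨3, by norm_num, by norm_num, ⟨e.trans (MulEquiv.funUnique _ _)⟩⟩
  · exact .inr (.inr (.inr (.inl ⟨e⟩)))

theorem not_mem_zpowers (hnc : ¬ IsCyclic G) (hgen : Subgroup.closure {x, y} = ⊤) :
    y ∉ Subgroup.zpowers x :=
  fun h => hnc (isCyclic_of_closure_pair hgen (Subgroup.mem_zpowers x) h)

/-- Two involutions whose product has order three generate the dihedral group of order six. -/
theorem inSmallGroups_of_dihedral [Finite G] (hnc : ¬ IsCyclic G)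
    (hgen : Subgroup.closure {x, y} = ⊤) (hx : x * x = 1) (hy : y * y = 1)
    (hxy : (x * y) * (x * y) * (x * y) = 1) : InSmallGroups G := by
  have hyx := not_mem_zpowers hnc hgen
  set r := x * y with hr
  have hr3 : r ^ 3 = 1 := by rw [pow_succ, pow_two, hxy]
  have hyr : y = x * r := by rw [hr, ← mul_assoc, hx, one_mul]
  have hxr : x ∉ Subgroup.zpowers r := by
    intro h
    refine hnc (isCyclic_of_closure_pair hgen h ?_)
    rw [hyr]
    exact mul_mem h (Subgroup.mem_zpowers r)
  let R : ZMod 3 → G := fun i => r ^ i.val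
  have hR : ∀ i j, R (i + j) = R i * R j := by
    intro i j
    simp only [R]
    rw [ZMod.val_add, ← pow_eq_pow_mod _ hr3, pow_add]
  have hRx1 : r * x = x * r ^ 2 := by
    have h2 : r ^ 2 = r⁻¹ := eq_inv_of_mul_eq_one_left (by rw [← pow_succ, hr3])
    have ex : x⁻¹ = x := inv_eq_of_mul_eq_one_left hx
    have ey : y⁻¹ = y := inv_eq_of_mul_eq_one_left hy
    rw [h2, hr, mul_inv_rev, ex, ey, mul_assoc]
  have hRx : ∀ i, R i * x = x * R (-i) := by
    have h1 : R 1 * x = x * R 2 := by simpa [R, ZMod.val_one, show (2 : ZMod 3).val = 2 from rfl]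
      using hRx1
    intro i
    have hcases : i = 0 ∨ i = 1 ∨ i = 2 := by revert i; decide
    rcases hcases with rfl | rfl | rfl
    · simp [R]
    · exact h1
    · rw [show (2 : ZMod 3) = 1 + 1 from rfl, hR, mul_assoc, h1, ← mul_assoc, h1, mul_assoc, ← hR]
      rfl
  let φ : DihedralGroup 3 →* G :=
    { toFun := fun g => match g with
        | .r i => R i
        | .sr i => x * R i
      map_one' := by
        change R 0 = 1
        simp [R]
      map_mul' := by
        rintro (i | i) (j | j)
        · exact hR i j
        · change x * R (j - i) = R i * (x * R j)
          rw [← mul_assoc, hRx, mul_assoc, ← hR, neg_add_eq_sub]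
        · change x * R (i + j) = x * R i * R j
          rw [hR, mul_assoc]
        · change R (j - i) = x * R i * (x * R j)
          rw [mul_assoc, ← mul_assoc (R i), hRx, ← mul_assoc, ← mul_assoc, hx, one_mul, ← hR,
            neg_add_eq_sub] }
  have hinj : Function.Injective φ := by
    rw [injective_iff_map_eq_one]
    rintro (i | i) h
    · have h' : r ^ i.val = 1 := h
      have hr1 : r ≠ 1 := by
        intro h1
        rw [h1, mul_one] at hyr
        exact hyx (hyr ▸ Subgroup.mem_zpowers _)
      have := orderOf_eq_prime hr3 hr1
      have hdvd := orderOf_dvd_of_pow_eq_one h'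
      rw [this] at hdvd
      have := Nat.eq_zero_of_dvd_of_lt hdvd (ZMod.val_lt i)
      rw [(ZMod.val_eq_zero i).1 this]
      rfl
    · have h' : x * r ^ i.val = 1 := h
      refine absurd ?_ hxr
      rw [eq_inv_of_mul_eq_one_left h']
      exact inv_mem (pow_mem (Subgroup.mem_zpowers r) _)
  have hsurj : Function.Surjective φ := by
    rw [← MonoidHom.range_eq_top, eq_top_iff, ← hgen, Subgroup.closure_le]
    have h1 : x ∈ φ.range := ⟨.sr 0, by change x * R 0 = x; simp [R]⟩
    have h2 : y ∈ φ.range := ⟨.sr 1, by change x * R 1 = y; simp [R, ZMod.val_one, hyr]⟩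
    rintro _ (rfl | rfl)
    exacts [h1, h2]
  exact .inr (.inr (.inr (.inr (.inl ⟨(MulEquiv.ofBijective φ ⟨hinj, hsurj⟩).symm⟩))))

open scoped Pointwise in
/-- An involution and an element of order three whose product has order three generate the
alternating group of degree four: the action on the cosets of the subgroup of order three is
faithful of degree four. -/
theorem inSmallGroups_of_alternating [Finite G] (hnc : ¬ IsCyclic G)
    (hgen : Subgroup.closure {x, y} = ⊤) (hx : x * x = 1) (hy : y * y * y = 1)
    (hxy : (x * y) * (x * y) * (x * y) = 1) : InSmallGroups G := by
  have hyx := not_mem_zpowers hnc hgen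
  have hxy' := not_mem_zpowers hnc (closure_swap hgen)
  have ex : x⁻¹ = x := inv_eq_of_mul_eq_one_left hx
  have ey : y⁻¹ = y * y := (eq_inv_of_mul_eq_one_left hy).symm
  have hy1 : y ≠ 1 := fun h => hyx (h ▸ one_mem _)
  have hy3 : y ^ 3 = 1 := by rw [pow_succ, pow_two, hy]
  set H := Subgroup.zpowers y
  have hHcard : Nat.card H = 3 := by
    rw [Nat.card_zpowers, orderOf_eq_prime hy3 hy1]
  have rel : x * y * x = y⁻¹ * x * y⁻¹ := by
    have : x * y * x * (y * x * y) = 1 := by rw [← hxy]; group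
    rw [eq_inv_of_mul_eq_one_left this, mul_inv_rev, mul_inv_rev, ex, mul_assoc]
  have rel' : x * y⁻¹ * x = y * x * y := by
    have := congrArg (·⁻¹) rel
    simpa [mul_inv_rev, ex, mul_assoc] using this
  let T : Set (G ⧸ H) := {((1 : G) : G ⧸ H), (x : G ⧸ H), ((y * x : G) : G ⧸ H),
    ((y⁻¹ * x : G) : G ⧸ H)}
  have hmk : ∀ g : G, ∀ h ∈ H, ((g * h : G) : G ⧸ H) = (g : G ⧸ H) := by
    intro g h hh
    exact QuotientGroup.mk_mul_of_mem g hh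
  have hyH : y ∈ H := Subgroup.mem_zpowers y
  have hT : MulAction.stabilizer G T = ⊤ := by
    rw [eq_top_iff, ← hgen, Subgroup.closure_le]
    have hfin : T.Finite := Set.toFinite _
    rintro _ (rfl | rfl)
    · refine (MulAction.mem_stabilizer_set' hfin).2 ?_
      rintro _ (rfl | rfl | rfl | rfl)
      · exact .inr (.inl (by rw [MulAction.Quotient.smul_coe, smul_eq_mul, mul_one]))
      · exact .inl (by rw [MulAction.Quotient.smul_coe, smul_eq_mul, hx])
      · refine .inr (.inr (.inr ?_))
        rw [Set.mem_singleton_iff, MulAction.Quotient.smul_coe, smul_eq_mul, ← mul_assoc, rel]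
        exact hmk _ _ (inv_mem hyH)
      · refine .inr (.inr (.inl ?_))
        rw [MulAction.Quotient.smul_coe, smul_eq_mul, ← mul_assoc, rel']
        exact hmk _ _ hyH
    · refine (MulAction.mem_stabilizer_set' hfin).2 ?_
      rintro _ (rfl | rfl | rfl | rfl)
      · refine .inl ?_
        rw [MulAction.Quotient.smul_coe, smul_eq_mul]
        simpa using hmk 1 _ hyH
      · exact .inr (.inr (.inl (by rw [MulAction.Quotient.smul_coe, smul_eq_mul])))
      · refine .inr (.inr (.inr ?_))
        rw [Set.mem_singleton_iff, MulAction.Quotient.smul_coe, smul_eq_mul, ← mul_assoc, ey]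
      · refine .inr (.inl ?_)
        rw [MulAction.Quotient.smul_coe, smul_eq_mul, mul_inv_cancel_left]
  have hTuniv : T = Set.univ := by
    rw [Set.eq_univ_iff_forall]
    intro g
    induction g using QuotientGroup.induction_on with
    | H g =>
      have hg : g ∈ MulAction.stabilizer G T := hT ▸ Subgroup.mem_top g
      have h1 : ((1 : G) : G ⧸ H) ∈ T := .inl rfl
      have := (MulAction.mem_stabilizer_set' (Set.toFinite T)).1 hg h1
      simpa [MulAction.Quotient.smul_coe] using this
  have hindex : Nat.card (G ⧸ H) ≤ 4 := by
    rw [← Set.ncard_univ, ← hTuniv]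
    refine (Set.ncard_insert_le _ _).trans (Nat.succ_le_succ ?_)
    refine (Set.ncard_insert_le _ _).trans (Nat.succ_le_succ ?_)
    exact (Set.ncard_insert_le _ _).trans (by simp)
  have hcore : H.normalCore = ⊥ := by
    by_contra hne
    have hcard : Nat.card H.normalCore = 3 := by
      have h1 := Subgroup.card_dvd_of_le H.normalCore_le
      rw [hHcard] at h1
      rcases (Nat.dvd_prime Nat.prime_three).1 h1 with h | h
      · exact absurd (Subgroup.card_eq_one.1 h) hne
      · exact h
    have heq : H.normalCore = H := Subgroup.eq_of_le_of_card_ge H.normalCore_le (by omega)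
    have hnormal : H.Normal := heq ▸ Subgroup.normalCore_normal H
    have hmem : x * y * x ∈ H := by
      have := hnormal.conj_mem y hyH x
      rwa [ex] at this
    -- now `y⁻¹ * x * y⁻¹` lies in `H`, and hence so does `x`
    rw [rel] at hmem
    refine hxy' ?_
    have := mul_mem (mul_mem hyH hmem) hyH
    simpa [mul_assoc] using this
  let f := MulAction.toPermHom G (G ⧸ H)
  have hf : Function.Injective f := by
    rw [← MonoidHom.ker_eq_bot_iff, ← Subgroup.normalCore_eq_ker, hcore]
  have hG3 : Nat.card (G ⧸ H) * 3 = Nat.card G := by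
    rw [← hHcard]
    exact H.index_mul_card
  have hle : Nat.card G ≤ (Nat.card (G ⧸ H)).factorial := by
    rw [← Nat.card_perm]
    exact Nat.card_le_card_of_injective f hf
  have h4 : Nat.card (G ⧸ H) = 4 := by
    have hpos : 0 < Nat.card (G ⧸ H) := Nat.card_pos
    generalize Nat.card (G ⧸ H) = n at *
    rw [← hG3] at hle
    interval_cases n <;> simp [Nat.factorial] at hle ⊢
  let e : G ⧸ H ≃ Fin 4 := Finite.equivFinOfCardEq h4
  let F : G →* Equiv.Perm (Fin 4) := e.permCongrHom.toMonoidHom.comp f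
  have hF : Function.Injective F := e.permCongrHom.injective.comp hf
  have hrange : F.range = alternatingGroup (Fin 4) := by
    apply Equiv.Perm.eq_alternatingGroup_of_index_eq_two
    have h1 := F.range.index_mul_card
    rw [Nat.card_perm, Nat.card_fin, ← Nat.card_congr (MonoidHom.ofInjective hF).toEquiv, ← hG3,
      h4] at h1
    simp [Nat.factorial] at h1
    omega
  exact .inr (.inr (.inr (.inr (.inr (.inl
    ⟨(MonoidHom.ofInjective hF).trans (MulEquiv.subgroupCongr hrange)⟩)))))

/-- Four cubes are enough to present the group of order `27` and exponent three: if `x`, `y`,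
`x * y` and `x * y⁻¹` have order dividing three, then `x⁻¹ * (y * x * y⁻¹)` is central, so that
all elements have the form `x ^ i * y ^ j * c ^ k`. -/
theorem inSmallGroups_of_cubes [Finite G] (hgen : Subgroup.closure {x, y} = ⊤)
    (hx : x * x * x = 1) (hy : y * y * y = 1) (hxy : (x * y) * (x * y) * (x * y) = 1)
    (hxy' : (x * y⁻¹) * (x * y⁻¹) * (x * y⁻¹) = 1) : InSmallGroups G := by
  have ey : y⁻¹ = y * y := (eq_inv_of_mul_eq_one_left hy).symm
  -- the conjugates of `x` by powers of `y` commute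
  set x₁ := y * x * y⁻¹ with hx₁
  set x₂ := y⁻¹ * x * y with hx₂
  have r1 : x₁ * x₂ = x⁻¹ := by
    refine eq_inv_of_mul_eq_one_right ?_
    rw [← hxy, hx₁, hx₂]
    have : y * x * y⁻¹ * (y⁻¹ * x * y) = y * x * (y * x * y) := by
      rw [← mul_assoc (y * x * y⁻¹), ← mul_assoc (y * x * y⁻¹), mul_assoc (y * x) y⁻¹ y⁻¹]
      rw [show y⁻¹ * y⁻¹ = y by rw [ey]; simp only [← mul_assoc, hy, one_mul]]
      simp only [mul_assoc]
    rw [this]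
    simp only [mul_assoc]
  have r2 : x₂ * x₁ = x⁻¹ := by
    refine eq_inv_of_mul_eq_one_right ?_
    rw [← hxy', hx₁, hx₂]
    have : y⁻¹ * x * y * (y * x * y⁻¹) = y⁻¹ * x * (y⁻¹ * x * y⁻¹) := by
      rw [ey]
      simp only [mul_assoc]
    rw [this]
    simp only [mul_assoc]
  have hc1 : x₁ * x₁ * x₁ = 1 := by
    rw [hx₁]
    have : y * x * y⁻¹ * (y * x * y⁻¹) * (y * x * y⁻¹) = y * (x * x * x) * y⁻¹ := by group
    rw [this, hx]
    group
  have hxx₁ : x * x₁ = x₁ * x := by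
    have h1 : x = (x₁ * x₂)⁻¹ := by rw [r1, inv_inv]
    have h2 : Commute x₁ x₂ := r1.trans r2.symm
    rw [h1]
    exact (((Commute.refl x₁).mul_right h2).inv_right).eq.symm
  set c := x⁻¹ * x₁ with hc
  have cx : Commute c x := (Commute.mul_left (Commute.inv_left (Commute.refl x)) hxx₁.symm)
  have cy : Commute c y := by
    have h1 : y * c * y⁻¹ = c := by
      have e1 : y * x₁ * y⁻¹ = x₂ := by
        have h2 : y⁻¹ * y⁻¹ = y := by rw [ey]; simp only [← mul_assoc, hy, one_mul]
        calc y * x₁ * y⁻¹ = (y * y) * x * (y⁻¹ * y⁻¹) := by rw [hx₁]; simp only [mul_assoc]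
          _ = x₂ := by rw [h2, ← ey]
      have e2 : y * c * y⁻¹ = x₁⁻¹ * x₂ := by
        rw [← e1, hc]
        nth_rewrite 2 [hx₁]
        group
      have e3 : x₂ = x₁⁻¹ * x⁻¹ := by rw [← r1, inv_mul_cancel_left]
      rw [e2, e3, ← mul_assoc, ← mul_inv_rev,
        inv_eq_of_mul_eq_one_left (a := x₁) (b := x₁ * x₁) (by rw [← mul_assoc]; exact hc1), hc]
      exact ((Commute.inv_left (show Commute x x₁ from hxx₁))).eq.symm
    exact (mul_inv_eq_iff_eq_mul.1 h1).symm
  have hc3 : c ^ 3 = 1 := by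
    have : Commute x⁻¹ x₁ := Commute.inv_left hxx₁
    rw [hc, this.mul_pow, inv_pow, pow_succ, pow_two, hx, pow_succ, pow_two, hc1]
    simp
  have hx3 : x ^ 3 = 1 := by rw [pow_succ, pow_two, hx]
  have hy3 : y ^ 3 = 1 := by rw [pow_succ, pow_two, hy]
  have hyx : y * x = x * y * c := by
    rw [mul_assoc, ← cy.eq, ← mul_assoc, hc, mul_inv_cancel_left, hx₁, inv_mul_cancel_right]
  clear_value c
  have comm1 : ∀ j : ℕ, y ^ j * x = x * y ^ j * c ^ j := by
    intro j
    induction j with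
    | zero => simp
    | succ j ih =>
      calc y ^ (j + 1) * x = y ^ j * (y * x) := by rw [pow_succ, mul_assoc]
        _ = y ^ j * x * y * c := by rw [hyx]; simp only [mul_assoc]
        _ = x * y ^ j * (c ^ j * y) * c := by rw [ih]; simp only [mul_assoc]
        _ = _ := by rw [(cy.pow_left j).eq, pow_succ, pow_succ]; simp only [mul_assoc]
  have comm : ∀ j i : ℕ, y ^ j * x ^ i = x ^ i * y ^ j * c ^ (i * j) := by
    intro j i
    induction i with
    | zero => simp
    | succ i ih =>
      rw [pow_succ, ← mul_assoc, ih, mul_assoc _ (c ^ (i * j)) x, (cx.pow_left _).eq, ← mul_assoc,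
        mul_assoc _ (y ^ j) x, comm1, add_mul, one_mul, add_comm (i * j), pow_add]
      simp only [mul_assoc]
  have mul_form : ∀ i j k i' j' k' : ℕ, (x ^ i * y ^ j * c ^ k) * (x ^ i' * y ^ j' * c ^ k') =
      x ^ (i + i') * y ^ (j + j') * c ^ (k + k' + i' * j) := by
    intro i j k i' j' k'
    have h1 : c ^ k * (x ^ i' * y ^ j') = x ^ i' * y ^ j' * c ^ k :=
      ((cx.pow_pow k i').mul_right (cy.pow_pow k j')).eq
    have h2 : c ^ (i' * j) * y ^ j' = y ^ j' * c ^ (i' * j) := (cy.pow_pow _ _).eq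
    calc (x ^ i * y ^ j * c ^ k) * (x ^ i' * y ^ j' * c ^ k')
        = x ^ i * y ^ j * (c ^ k * (x ^ i' * y ^ j')) * c ^ k' := by simp only [mul_assoc]
      _ = x ^ i * (y ^ j * x ^ i') * y ^ j' * c ^ k * c ^ k' := by
          rw [h1]; simp only [mul_assoc]
      _ = x ^ i * x ^ i' * y ^ j * (c ^ (i' * j) * y ^ j') * c ^ k * c ^ k' := by
          rw [comm]; simp only [mul_assoc]
      _ = _ := by
          rw [h2, pow_add, pow_add, add_comm (k + k'), pow_add, pow_add]; simp only [mul_assoc]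
  have form : ∀ g : G, ∃ i j k : ℕ, g = x ^ i * y ^ j * c ^ k := by
    intro g
    have hg : g ∈ Subgroup.closure {x, y} := hgen ▸ Subgroup.mem_top g
    induction hg using Subgroup.closure_induction with
    | mem z hz =>
      rcases hz with rfl | rfl
      · exact ⟨1, 0, 0, by simp⟩
      · exact ⟨0, 1, 0, by simp⟩
    | one => exact ⟨0, 0, 0, by simp⟩
    | mul z w _ _ hz hw =>
      obtain ⟨i, j, k, rfl⟩ := hz
      obtain ⟨i', j', k', rfl⟩ := hw
      exact ⟨_, _, _, mul_form _ _ _ _ _ _⟩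
    | inv z _ hz =>
      obtain ⟨i, j, k, rfl⟩ := hz
      refine ⟨2 * i, 2 * j, 2 * k + 2 * i * j * 2, inv_eq_of_mul_eq_one_right ?_⟩
      rw [mul_form, show i + 2 * i = 3 * i by ring, show j + 2 * j = 3 * j by ring,
        show k + (2 * k + 2 * i * j * 2) + 2 * i * j = 3 * (k + 2 * i * j) by ring,
        pow_mul, pow_mul, pow_mul, hx3, hy3, hc3]
      simp
  have cube : ∀ g : G, g ^ 3 = 1 := by
    intro g
    obtain ⟨i, j, k, rfl⟩ := form g
    rw [pow_succ, pow_two, mul_form, mul_form, show i + i + i = 3 * i by ring,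
      show j + j + j = 3 * j by ring,
      show k + k + i * j + k + i * (j + j) = 3 * (k + i * j) by ring,
      pow_mul, pow_mul, pow_mul, hx3, hy3, hc3]
    simp
  by_cases hcomm : ∀ g h : G, g * h = h * g
  · exact inSmallGroups_of_comm_of_cube_eq_one hcomm cube hgen
  have hne : ∃ a b : G, a * b ≠ b * a := by
    push Not at hcomm
    exact hcomm
  have hcard : Nat.card G ≤ 27 := by
    let φ : Fin 3 × Fin 3 × Fin 3 → G := fun t => x ^ t.1.val * y ^ t.2.1.val * c ^ t.2.2.val
    have hφ : Function.Surjective φ := by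
      intro g
      obtain ⟨i, j, k, rfl⟩ := form g
      refine ⟨(⟨i % 3, Nat.mod_lt _ (by norm_num)⟩, ⟨j % 3, Nat.mod_lt _ (by norm_num)⟩,
        ⟨k % 3, Nat.mod_lt _ (by norm_num)⟩), ?_⟩
      simp only [φ]
      rw [← pow_eq_pow_mod i hx3, ← pow_eq_pow_mod j hy3, ← pow_eq_pow_mod k hc3]
    refine (Nat.card_le_card_of_surjective φ hφ).trans ?_
    simp
  obtain ⟨n, hn⟩ := (IsPGroup.iff_card (p := 3) (G := G)).1 fun g => ⟨1, by simpa using cube g⟩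
  have hn3 : Nat.card G = 27 := by
    have hnle : n ≤ 3 := by
      by_contra hlt
      have := Nat.pow_le_pow_right (show 0 < 3 by norm_num) (show 4 ≤ n by omega)
      omega
    interval_cases n
    · have := (Nat.card_eq_one_iff_unique.1 (by simpa using hn)).1
      exact absurd (fun g h => Subsingleton.elim _ _) hcomm
    · have := isCyclic_of_prime_card (p := 3) (by simpa using hn)
      exact absurd (fun g h => this.isMulCommutative.is_comm.comm g h) hcomm
    · have := IsPGroup.isMulCommutative_of_card_eq_prime_sq (p := 3) hn
      exact absurd (fun g h => this.is_comm.comm g h) hcomm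
    · simpa using hn
  refine .inr (.inr (.inr (.inr (.inr (.inr ⟨hn3, ?_, hne⟩)))))
  have hexp := Monoid.exponent_dvd_of_forall_pow_eq_one cube
  rcases (Nat.dvd_prime Nat.prime_three).1 hexp with h | h
  · have := Monoid.exp_eq_one_iff.1 h
    exact absurd (fun g h => Subsingleton.elim _ _) hcomm
  · exact h

/-- A non-cyclic group with two generators that is not one of the excluded groups has a generating
pair with an element of order at least four. -/
theorem exists_pair_of_not_inSmallGroups [Finite G] (hnc : ¬ IsCyclic G)
    (hsmall : ¬ InSmallGroups G) (hgen : Subgroup.closure {x, y} = ⊤) :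
    ∃ x y : G, Subgroup.closure {x, y} = ⊤ ∧ x * x ≠ 1 ∧ x * x * x ≠ 1 := by
  classical
  by_contra hno
  have H : ∀ x y : G, Subgroup.closure {x, y} = ⊤ → x * x = 1 ∨ x * x * x = 1 := by
    intro x y h
    by_contra hxy
    exact hno ⟨x, y, h, fun h' => hxy (.inl h'), fun h' => hxy (.inr h')⟩
  have mulgen : ∀ {x y : G}, Subgroup.closure {x, y} = ⊤ → Subgroup.closure {x * y, y} = ⊤ :=
    fun h => closure_swap (closure_pair_mul (closure_swap h))
  have two_two : ∀ x y : G, Subgroup.closure {x, y} = ⊤ → x * x = 1 → y * y = 1 → False := by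
    intro x y h hx hy
    rcases H _ _ (mulgen h) with h2 | h3
    · have hcomm : x * y = y * x := by
        have ex : x⁻¹ = x := inv_eq_of_mul_eq_one_left hx
        have ey : y⁻¹ = y := inv_eq_of_mul_eq_one_left hy
        rw [← inv_eq_of_mul_eq_one_left h2, mul_inv_rev, ex, ey]
      have hcomm' := mul_comm_of_closure h (by
        rintro s (rfl | rfl) t (rfl | rfl)
        exacts [rfl, hcomm, hcomm.symm, rfl])
      have hsq : ∀ g : G, g * g = 1 := by
        intro g
        have hg : g ∈ Subgroup.closure {x, y} := h ▸ Subgroup.mem_top g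
        induction hg using Subgroup.closure_induction with
        | mem z hz => rcases hz with rfl | rfl <;> assumption
        | one => simp
        | mul z w _ _ hz hw => rw [mul_assoc, ← mul_assoc w, hcomm' w z, mul_assoc, hw, mul_one, hz]
        | inv z _ hz => rw [← mul_inv_rev, hz, inv_one]
      exact hsmall (inSmallGroups_of_sq_eq_one hsq {x, y} (by simpa using h)
        (Finset.card_le_two.trans (by norm_num)))
    · exact hsmall (inSmallGroups_of_dihedral hnc h hx hy h3)
  have two_three : ∀ x y : G, Subgroup.closure {x, y} = ⊤ → x * x = 1 → y * y * y = 1 →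
      False := by
    intro x y h hx hy
    have h' : Subgroup.closure {x * y, x} = ⊤ := by
      have h1 : x * y ∈ Subgroup.closure {x * y, x} := Subgroup.subset_closure (by simp)
      have h2 : x ∈ Subgroup.closure {x * y, x} := Subgroup.subset_closure (by simp)
      exact closure_pair_eq_top h h2 (by simpa using mul_mem (inv_mem h2) h1)
    rcases H _ _ h' with h2 | h3
    · exact two_two _ _ h' h2 hx
    · exact hsmall (inSmallGroups_of_alternating hnc h hx hy h3)
  have any_three : ∀ x y : G, Subgroup.closure {x, y} = ⊤ → y * y * y = 1 → x * x * x = 1 := by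
    intro x y h hy
    exact (H _ _ h).resolve_left fun hx => two_three _ _ h hx hy
  have hy : y * y * y = 1 := by
    refine (H _ _ (closure_swap hgen)).resolve_left fun hy => ?_
    rcases H _ _ hgen with hx | hx
    · exact two_two _ _ hgen hx hy
    · exact two_three _ _ (closure_swap hgen) hy hx
  have hx := any_three _ _ hgen hy
  have hxy := any_three _ _ (mulgen hgen) hy
  have hgen' : Subgroup.closure {x * y⁻¹, y} = ⊤ := by
    have h1 : x * y⁻¹ ∈ Subgroup.closure {x * y⁻¹, y} := Subgroup.subset_closure (by simp)
    have h2 : y ∈ Subgroup.closure {x * y⁻¹, y} := Subgroup.subset_closure (by simp)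
    exact closure_pair_eq_top hgen (by simpa using mul_mem h1 h2) h2
  exact hsmall (inSmallGroups_of_cubes hgen hx hy hxy (any_three _ _ hgen' hy))

end SmallGroups

/-! ### Choosing the labels -/

section Labels

variable {G : Type*} [Group G] {x y a b : G}

theorem eight_le_card_of_pair [Finite G] (hnc : ¬ IsCyclic G)
    (hgen : Subgroup.closure {x, y} = ⊤) (hxx : x * x ≠ 1) (hxxx : x * x * x ≠ 1) :
    8 ≤ Nat.card G := by
  have hmem := not_mem_zpowers hnc hgen
  have hx : x ≠ 1 := by rintro rfl; simp at hxx
  have h4 : 4 ≤ Nat.card (Subgroup.zpowers x) := by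
    rw [Nat.card_zpowers]
    have hpos := orderOf_pos x
    have hpow := pow_orderOf_eq_one x
    by_contra hlt
    have : orderOf x = 1 ∨ orderOf x = 2 ∨ orderOf x = 3 := by omega
    rcases this with h | h | h <;> rw [h] at hpow
    · exact hx (by simpa using hpow)
    · exact hxx (by simpa [pow_two] using hpow)
    · exact hxxx (by simpa [pow_succ] using hpow)
  have hlt : Subgroup.zpowers x ≠ ⊤ := fun h => hmem (h ▸ Subgroup.mem_top y)
  obtain ⟨k, hk⟩ := Subgroup.card_subgroup_dvd_card (Subgroup.zpowers x)
  have hpos : 0 < Nat.card G := Nat.card_pos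
  have hk1 : k ≠ 1 := by
    rintro rfl
    exact hlt (Subgroup.eq_top_of_card_eq _ (by omega))
  have hk0 : k ≠ 0 := by rintro rfl; omega
  have hk2 : 2 ≤ k := by omega
  rw [hk]
  nlinarith

/-- If `x` has order at least four and `x ^ 2 = y ^ 2 = (y * x) ^ 2`, then `y` inverts `x` and
`x ^ 4 = 1`, as in the quaternion group. Labels `x ^ 2`, `x`, `y`, `x * y` work: as `x ^ 2` is an
involution and `x` is not, the two outer layers cannot be exchanged. -/
theorem hasHaarRepresentation_three_of_quaternion [Finite G] (hnc : ¬ IsCyclic G)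
    (hgen : Subgroup.closure {x, y} = ⊤) (hxx : x * x ≠ 1) (hxxx : x * x * x ≠ 1)
    (hyy : y * y = x * x) (hyx : (y * x) * (y * x) = x * x) : HasHaarRepresentation 3 G := by
  have hmem := not_mem_zpowers hnc hgen
  have hxm := Subgroup.mem_zpowers x
  have hx : x ≠ 1 := by rintro rfl; simp at hxx
  -- `y * x * y = x` and `y ^ 2 = x ^ 2` give `x ^ 4 = 1`
  have h1 : y * x * y = x := by
    have : (y * x * y) * x = x * x := by rw [← hyx]; simp only [mul_assoc]
    exact mul_right_cancel this
  have h2 : x * x * (x * x) = 1 := by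
    have e1 : y * (x * x) = x * x * y := by rw [← hyy, mul_assoc]
    have e2 : y * x * y⁻¹ = x⁻¹ := by
      rw [mul_inv_eq_iff_eq_mul, eq_inv_mul_iff_mul_eq, ← mul_assoc,
        ← mul_left_inj y, mul_assoc x, mul_assoc x, h1, hyy]
    have e3 : y * (x * x) * y⁻¹ = x⁻¹ * x⁻¹ := by rw [← e2]; group
    rw [e1, mul_inv_cancel_right] at e3
    rw [← mul_inv_rev] at e3
    exact mul_eq_one_iff_eq_inv.2 e3
  have hx4 : x⁻¹ = x * x * x := by
    refine (eq_inv_of_mul_eq_one_left ?_).symm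
    rw [← h2]; simp only [mul_assoc]
  have hm : ∀ g ∈ Subgroup.zpowers x, y ≠ g := fun g hg h => hmem (h ▸ hg)
  have hm' : ∀ g ∈ Subgroup.zpowers x, x * y ≠ g := by
    intro g hg h
    refine hmem ?_
    rw [eq_inv_mul_of_mul_eq h]
    exact mul_mem (inv_mem hxm) hg
  have hm'' : ∀ g ∈ Subgroup.zpowers x, x * y * (x * x) ≠ g := by
    intro g hg h
    exact hm' _ (mul_mem hg (inv_mem (mul_mem hxm hxm))) (eq_mul_inv_of_mul_eq h)
  have hYX : x * y * y = x⁻¹ := by rw [mul_assoc, hyy, hx4, mul_assoc]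
  have h1m := one_mem (Subgroup.zpowers x)
  have hxxm := mul_mem hxm hxm
  refine hasHaarRepresentation_three_of_labels (a := x * x) (b := x) (x := y) (y := x * y)
    ⟨hxx, hx, fun h => hx (mul_eq_left.1 h), fun h => hxxx (by rw [← h, mul_assoc]),
      hm _ h1m, hm _ hxxm, hm _ hxm, hm' _ h1m, hm' _ hxxm, hm' _ h1m, hm' _ hxm, hm' _ hxxm,
      hm'' _ h1m, hm'' _ hxm, ?_, ?_, ?_⟩
    (eight_le_card_of_pair hnc hgen hxx hxxx) ?_ ?_
  · rw [hYX]
    exact inv_ne_one.2 hx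
  · rw [hYX, hx4]
    intro h
    exact hx (mul_eq_left.1 h)
  · rw [hYX, hx4]
    intro h
    exact hxx (mul_eq_right.1 h)
  · refine eq_top_iff.2 (hgen ▸ (Subgroup.closure_mono ?_))
    rintro _ (rfl | rfl) <;> simp
  · intro q h1 h2' _ _
    have e1 := h1 1
    have e2 := h1 (x * x * 1)
    rw [← mul_assoc, h2, h1, ← mul_assoc, one_mul] at e2
    have e3 : x⁻¹ * x⁻¹ = 1 := by
      have := e2.symm
      rwa [mul_eq_right] at this
    exact hxx (by rwa [← mul_inv_rev, inv_eq_one] at e3)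

theorem hasHaarRepresentation_three_of_sq_ne [Finite G] (hnc : ¬ IsCyclic G)
    (hgen : Subgroup.closure {x, y} = ⊤) (hcard : 7 ≤ Nat.card G) (hxx : x * x ≠ 1)
    (hxxx : x * x * x ≠ 1) (hyy : y * y ≠ x * x) : HasHaarRepresentation 3 G := by
  have hmem := not_mem_zpowers hnc hgen
  have hxm := Subgroup.mem_zpowers x
  have hxy := not_mem_zpowers hnc (closure_swap hgen)
  refine hasHaarRepresentation_three_of_pair hcard hxx hxxx ?_ ?_ ?_ ?_ ?_ ?_ hyy hgen
  · rintro rfl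
    exact hmem (one_mem _)
  · intro h
    exact hmem (eq_inv_of_mul_eq_one_left h ▸ inv_mem hxm)
  · intro h
    exact hmem (eq_inv_of_mul_eq_one_right h ▸ inv_mem (mul_mem hxm hxm))
  · intro h
    refine hmem ?_
    have h1 : x * x * y = x⁻¹ := eq_inv_of_mul_eq_one_left h
    rw [eq_inv_mul_of_mul_eq h1]
    exact mul_mem (inv_mem (mul_mem hxm hxm)) (inv_mem hxm)
  · rintro rfl
    exact hmem (mul_mem hxm hxm)
  · intro h
    refine hxy ?_
    rw [← h]
    exact mul_mem (Subgroup.mem_zpowers y) (Subgroup.mem_zpowers y)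

/-- A finite non-cyclic group generated by `x` and `y`, with `x` of order at least four, has an
`m`-HGR for all `m ≥ 3`. -/
theorem hasHaarRepresentation_of_pair [Finite G] (hnc : ¬ IsCyclic G)
    (hgen : Subgroup.closure {x, y} = ⊤) (hxx : x * x ≠ 1) (hxxx : x * x * x ≠ 1) {m : ℕ}
    (hm : 3 ≤ m) : HasHaarRepresentation m G := by
  have hcard := eight_le_card_of_pair hnc hgen hxx hxxx
  have hmem := not_mem_zpowers hnc hgen
  have hxm := Subgroup.mem_zpowers x
  have hx : x ≠ 1 := by rintro rfl; simp at hxx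
  rcases hm.eq_or_lt with rfl | hm
  · by_cases h1 : y * y = x * x
    · by_cases h2 : (y * x) * (y * x) = x * x
      · exact hasHaarRepresentation_three_of_quaternion hnc hgen hxx hxxx h1 h2
      · exact hasHaarRepresentation_three_of_sq_ne hnc (closure_pair_mul hgen) (by omega) hxx hxxx
          h2
    · exact hasHaarRepresentation_three_of_sq_ne hnc hgen (by omega) hxx hxxx h1
  · have hm' : ∀ g ∈ Subgroup.zpowers x, y ≠ g := fun g hg h => hmem (h ▸ hg)
    refine hasHaarRepresentation_of_four_le (a := x) (v := y) (b := x * x) hm (by omega) hx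
      (hm' _ (one_mem _)) (hm' _ hxm) (hm' _ (mul_mem hxm hxm)) hxx
      (hm' _ (mul_mem hxm hxm)).symm (fun h => hx (mul_eq_left.1 h)) ?_ ?_
    · intro h
      exact hm' _ (mul_mem (mul_mem hxm hxm) hxm) (eq_mul_inv_iff_mul_eq.1 h).symm
    · refine eq_top_iff.2 (hgen ▸ Subgroup.closure_mono ?_)
      rintro _ (rfl | rfl) <;> simp

theorem hasHaarRepresentation_of_isCyclic [Finite G] (hG : IsCyclic G) (hcard : 7 ≤ Nat.card G)
    {m : ℕ} (hm : 3 ≤ m) : HasHaarRepresentation m G := by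
  obtain ⟨x, hx⟩ := isCyclic_iff_exists_zpowers_eq_top.1 hG
  have hord : orderOf x = Nat.card G := by
    rw [← Nat.card_zpowers, hx, Nat.card_congr Subgroup.topEquiv.toEquiv]
  have hp : ∀ i j : ℕ, ∀ {g h : G}, g = x ^ i → h = x ^ j → (i ≠ j ∧ i < 7 ∧ j < 7) → g ≠ h := by
    rintro i j g h rfl rfl ⟨hij, hi, hj⟩ heq
    have hmod := pow_eq_pow_iff_modEq.1 heq
    rw [hord] at hmod
    exact hij (hmod.eq_of_lt_of_lt (by omega) (by omega))
  have hgen : Subgroup.closure {x} = ⊤ := by rw [← Subgroup.zpowers_eq_closure, hx]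
  have e0 : 1 = x ^ 0 := (pow_zero x).symm
  have e1 : x = x ^ 1 := (pow_one x).symm
  have e2 : x * x = x ^ 2 := (pow_two x).symm
  have e3 : x * x * x = x ^ 3 := by rw [pow_succ, pow_two]
  have e4 : x ^ 3 * x = x ^ 4 := (pow_succ x 3).symm
  have e5 : x * x * x ^ 3 = x ^ 5 := by rw [e2, ← pow_add]
  have e6 : x * x * x ^ 3 * x = x ^ 6 := by rw [e5, ← pow_succ]
  have e2' : x ^ 3 * x⁻¹ = x ^ 2 := by rw [pow_succ, mul_inv_cancel_right]
  have e6' : x ^ 3 * x ^ 3 = x ^ 6 := (pow_add x 3 3).symm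
  rcases hm.eq_or_lt with rfl | hm
  · refine hasHaarRepresentation_three_of_pair (x := x) (y := x ^ 3) hcard
      (hp 2 0 e2 e0 (by simp)) (hp 3 0 e3 e0 (by simp)) (hp 3 0 rfl e0 (by simp))
      (hp 4 0 e4 e0 (by simp)) (hp 5 0 e5 e0 (by simp)) (hp 6 0 e6 e0 (by simp))
      (hp 3 2 rfl e2 (by simp)) (hp 6 1 e6' e1 (by simp)) (hp 6 2 e6' e2 (by simp))
      (eq_top_iff.2 (hgen ▸ Subgroup.closure_mono (by simp)))
  · refine hasHaarRepresentation_of_four_le (a := x) (v := x ^ 3) (b := x ^ 4) hm hcard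
      (hp 1 0 e1 e0 (by simp)) (hp 3 0 rfl e0 (by simp)) (hp 3 1 rfl e1 (by simp))
      (hp 3 2 rfl e2 (by simp)) (hp 4 0 rfl e0 (by simp)) (hp 4 3 rfl rfl (by simp))
      (hp 4 1 rfl e1 (by simp)) (hp 4 2 rfl e2' (by simp))
      (eq_top_iff.2 (hgen ▸ Subgroup.closure_mono (by simp)))

/-- Three generators `a, b, c` for which `⟨a, b⟩` is neither cyclic nor of order less than six, and
does not contain `c`. For `m = 3` the label `y` is taken from `⟨a, b⟩`; it cannot be exchanged
with the label `c` up to inversion, since a symmetry exchanging `a` and `b` up to inversion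
preserves the cosets of `⟨a, b⟩`. -/
theorem hasHaarRepresentation_of_triple [Finite G] {a b c : G}
    (hgen : Subgroup.closure {a, b, c} = ⊤) (hnc : ¬ IsCyclic (Subgroup.closure {a, b}))
    (hc : c ∉ Subgroup.closure {a, b}) (hcard : 6 ≤ Nat.card (Subgroup.closure {a, b})) {m : ℕ}
    (hm : 3 ≤ m) : HasHaarRepresentation m G := by
  classical
  set H := Subgroup.closure {a, b}
  have haH : a ∈ H := Subgroup.subset_closure (by simp)
  have hbH : b ∈ H := Subgroup.subset_closure (by simp)
  have hcH : ∀ g ∈ H, c ≠ g := fun g hg h => hc (h ▸ hg)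
  have hcyc : ∀ z, a ∈ Subgroup.zpowers z → b ∈ Subgroup.zpowers z → False := by
    intro z ha hb
    have hle : H ≤ Subgroup.zpowers z := by
      refine (Subgroup.closure_le _).2 ?_
      rintro _ (rfl | rfl)
      exacts [ha, hb]
    exact hnc (Subgroup.isCyclic_of_le hle)
  have hab : b ∉ Subgroup.zpowers a := fun h => hcyc a (Subgroup.mem_zpowers a) h
  have hba : a ∉ Subgroup.zpowers b := fun h => hcyc b h (Subgroup.mem_zpowers b)
  have ha1 : a ≠ 1 := fun h => hba (h ▸ one_mem _)
  have hb1 : b ≠ 1 := fun h => hab (h ▸ one_mem _)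
  have hane : a ≠ b := fun h => hba (h ▸ Subgroup.mem_zpowers _)
  have hbainv : b * a ≠ 1 := fun h =>
    hab (eq_inv_of_mul_eq_one_left h ▸ inv_mem (Subgroup.mem_zpowers a))
  have hG : 2 * Nat.card H ≤ Nat.card G := by
    have hlt : H ≠ ⊤ := fun h => hc (h ▸ Subgroup.mem_top c)
    obtain ⟨k, hk⟩ := Subgroup.card_subgroup_dvd_card H
    have hpos : 0 < Nat.card G := Nat.card_pos
    have hk1 : k ≠ 1 := by
      rintro rfl
      exact hlt (Subgroup.eq_top_of_card_eq _ (by omega))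
    have hk0 : k ≠ 0 := by rintro rfl; omega
    have hk2 : 2 ≤ k := by omega
    rw [hk]
    nlinarith
  rcases hm.eq_or_lt with rfl | hm
  · obtain ⟨y, hyH, hy⟩ : ∃ y ∈ H, y ∉ ({1, a, b, a⁻¹, b * a⁻¹} : Finset G) := by
      by_contra! hno
      have hsub : (H : Set G) ⊆ ({1, a, b, a⁻¹, b * a⁻¹} : Finset G) := hno
      have h1 := Set.ncard_le_ncard hsub (Finset.finite_toSet _)
      rw [Set.ncard_coe_finset, ← Nat.card_coe_set_eq] at h1
      have h2 : ({1, a, b, a⁻¹, b * a⁻¹} : Finset G).card ≤ 5 := Finset.card_le_five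
      have h3 : Nat.card (H : Set G) = Nat.card H := rfl
      omega
    simp only [Finset.mem_insert, Finset.mem_singleton, not_or] at hy
    obtain ⟨hy1, hya, hyb, hya', hyab⟩ := hy
    refine hasHaarRepresentation_three_of_labels (a := a) (b := b) (x := c) (y := y)
      ⟨ha1, hb1, hane, hbainv, hcH _ (one_mem _), hcH _ haH, hcH _ hbH, ?_, ?_, hy1, hyb, hya,
        fun h => hya' (eq_inv_of_mul_eq_one_left h), fun h => hyab (eq_mul_inv_of_mul_eq h),
        ?_, ?_, ?_⟩ (by omega) ?_ ?_
    · exact fun h => hcH _ (inv_mem hbH) (eq_inv_of_mul_eq_one_right h)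
    · exact fun h => hcH _ (mul_mem (inv_mem hbH) haH) (eq_inv_mul_of_mul_eq h)
    · exact fun h => hcH _ (inv_mem hyH) (eq_inv_of_mul_eq_one_right h)
    · exact fun h => hcH _ (mul_mem (inv_mem hyH) haH) (eq_inv_mul_of_mul_eq h)
    · exact fun h => hcH _ (mul_mem (inv_mem hyH) hbH) (eq_inv_mul_of_mul_eq h)
    · refine eq_top_iff.2 (hgen ▸ Subgroup.closure_mono ?_)
      rintro _ (rfl | rfl | rfl) <;> simp
    · intro q qa qb _ qy
      have key : ∀ h ∈ H, ∀ g, q (h * g) * (q g)⁻¹ ∈ H := by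
        intro h hh
        induction hh using Subgroup.closure_induction with
        | mem z hz =>
          intro g
          rcases hz with rfl | rfl
          · rw [qa, mul_inv_cancel_right]
            exact inv_mem hbH
          · rw [qb, mul_inv_cancel_right]
            exact inv_mem haH
        | one => simp
        | mul z w _ _ hz hw =>
          intro g
          have := mul_mem (hz (w * g)) (hw g)
          rwa [mul_assoc, inv_mul_cancel_left, ← mul_assoc] at this
        | inv z _ hz =>
          intro g
          have := inv_mem (hz (z⁻¹ * g))
          rwa [mul_inv_cancel_left, mul_inv_rev, inv_inv] at this
      have := key y hyH 1
      rw [qy, mul_inv_cancel_right] at this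
      exact hc (by simpa using inv_mem this)
  · refine hasHaarRepresentation_of_four_le (a := a) (v := b) (b := c) hm (by omega) ha1 hb1
      hane.symm (fun h => hab (h ▸ mul_mem (Subgroup.mem_zpowers a) (Subgroup.mem_zpowers a)))
      (hcH _ (one_mem _)) (hcH _ hbH) (hcH _ haH) (hcH _ (mul_mem hbH (inv_mem haH))) hgen

theorem sq_eq_one_of_closure_pair_card_lt_six [Finite G] {a b : G}
    (hnc : ¬ IsCyclic (Subgroup.closure {a, b})) (hcard : Nat.card (Subgroup.closure {a, b}) < 6) :
    a * a = 1 ∧ a * b = b * a := by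
  set H := Subgroup.closure {a, b}
  have hpos : 0 < Nat.card H := Nat.card_pos
  have h4 : Nat.card H = 4 := by
    by_contra hne
    have hcases : Nat.card H = 1 ∨ Nat.card H = 2 ∨ Nat.card H = 3 ∨ Nat.card H = 5 := by omega
    rcases hcases with h | h | h | h
    · have := (Nat.card_eq_one_iff_unique.1 h).1
      exact hnc inferInstance
    · exact hnc (isCyclic_of_prime_card (p := 2) h)
    · exact hnc (isCyclic_of_prime_card (p := 3) h)
    · have : Fact (Nat.Prime 5) := ⟨by norm_num⟩
      exact hnc (isCyclic_of_prime_card (p := 5) h)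
  let a' : H := ⟨a, Subgroup.subset_closure (by simp)⟩
  let b' : H := ⟨b, Subgroup.subset_closure (by simp)⟩
  have hcomm := (IsPGroup.isMulCommutative_of_card_eq_prime_sq (G := H) (p := 2) h4).is_comm.comm
  refine ⟨?_, congrArg Subtype.val (hcomm a' b')⟩
  have hdvd : orderOf a' ∣ 2 ^ 2 := by
    have h := orderOf_dvd_natCard a'
    rwa [h4] at h
  obtain ⟨k, hk, hk'⟩ := (Nat.dvd_prime_pow Nat.prime_two).1 hdvd
  have hk2 : k ≠ 2 := by
    rintro rfl
    exact hnc (isCyclic_of_orderOf_eq_card a' (by rw [hk', h4]; norm_num))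
  have h2 : orderOf a' ∣ 2 := by
    rw [hk']
    exact (Nat.pow_dvd_pow 2 (show k ≤ 1 by omega)).trans (by norm_num)
  have := orderOf_dvd_iff_pow_eq_one.1 h2
  rw [pow_two] at this
  exact congrArg Subtype.val this

theorem exists_closure_eq_of_isCyclic {a b c : G} (hgen : Subgroup.closure {a, b, c} = ⊤)
    (h : IsCyclic (Subgroup.closure {a, b})) : ∃ z, Subgroup.closure {z, c} = ⊤ := by
  obtain ⟨z, hz⟩ := h.exists_generator
  refine ⟨z, eq_top_iff.2 (hgen ▸ (Subgroup.closure_le _).2 ?_)⟩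
  have hz' : (z : G) ∈ Subgroup.closure {(z : G), c} := Subgroup.subset_closure (by simp)
  have hsub : ∀ g ∈ Subgroup.closure {a, b}, g ∈ Subgroup.closure {(z : G), c} := by
    intro g hg
    obtain ⟨n, hn⟩ := hz ⟨g, hg⟩
    have : (z : G) ^ n = g := congrArg Subtype.val hn
    exact this ▸ zpow_mem hz' n
  rintro _ (rfl | rfl | rfl)
  · exact hsub _ (Subgroup.subset_closure (by simp))
  · exact hsub _ (Subgroup.subset_closure (by simp))
  · exact Subgroup.subset_closure (by simp)

end Labels

/-- `Group.rank G` is the smallest size `d(G)` of a generating set of `G`. -/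
theorem proposition4p5 (G : Type*) [Group G] [Finite G] (hd : Group.rank G ≤ 3)
    (hG : ¬ InSmallGroups G) (m : ℕ) (hm : 3 ≤ m) :
    HasHaarRepresentation m G := by
  classical
  by_cases hcyc : IsCyclic G
  · refine hasHaarRepresentation_of_isCyclic hcyc ?_ hm
    by_contra hlt
    exact hG (inSmallGroups_of_isCyclic hcyc (by omega))
  by_cases hpair : ∃ x y : G, Subgroup.closure {x, y} = ⊤
  · obtain ⟨x, y, hgen⟩ := hpair
    obtain ⟨x, y, hgen, hxx, hxxx⟩ := exists_pair_of_not_inSmallGroups hcyc hG hgen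
    exact hasHaarRepresentation_of_pair hcyc hgen hxx hxxx hm
  have hno : ∀ x y : G, Subgroup.closure {x, y} ≠ ⊤ := fun x y h => hpair ⟨x, y, h⟩
  obtain ⟨a, b, c, hgen⟩ : ∃ a b c : G, Subgroup.closure {a, b, c} = ⊤ := by
    obtain ⟨S, hS, hgen⟩ := Group.rank_spec G
    have h3 : S.card = 3 := by
      by_contra hne
      have hlt : S.card = 0 ∨ S.card = 1 ∨ S.card = 2 := by omega
      rcases hlt with h | h | h
      · rw [Finset.card_eq_zero.1 h] at hgen
        exact hno 1 1 (eq_top_iff.2 (hgen ▸ Subgroup.closure_mono (by simp)))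
      · obtain ⟨x, rfl⟩ := Finset.card_eq_one.1 h
        exact hno x x (by simpa using hgen)
      · obtain ⟨x, y, -, rfl⟩ := Finset.card_eq_two.1 h
        exact hno x y (by simpa using hgen)
    obtain ⟨a, b, c, -, -, -, rfl⟩ := Finset.card_eq_three.1 h3
    exact ⟨a, b, c, by simpa using hgen⟩
  -- every pair of the generators spans a non-cyclic group that misses the third generator
  have big : ∀ a b c : G, Subgroup.closure {a, b, c} = ⊤ →
      ¬ HasHaarRepresentation m G → a * a = 1 ∧ a * b = b * a := by
    intro a b c hgen hH
    have hnc : ¬ IsCyclic (Subgroup.closure {a, b}) := fun h =>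
      hpair ⟨_, _, (exists_closure_eq_of_isCyclic hgen h).choose_spec⟩
    have hc : c ∉ Subgroup.closure {a, b} := by
      intro hc
      refine hno a b (eq_top_iff.2 (hgen ▸ (Subgroup.closure_le _).2 ?_))
      rintro _ (rfl | rfl | rfl)
      · exact Subgroup.subset_closure (by simp)
      · exact Subgroup.subset_closure (by simp)
      · exact hc
    refine sq_eq_one_of_closure_pair_card_lt_six hnc ?_
    by_contra hcard
    exact hH (hasHaarRepresentation_of_triple hgen hnc hc (by omega) hm)
  by_contra hH
  have hbca : Subgroup.closure {b, c, a} = ⊤ := by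
    rwa [show ({b, c, a} : Set G) = {a, b, c} by ext; simp; tauto]
  have hcab : Subgroup.closure {c, a, b} = ⊤ := by
    rwa [show ({c, a, b} : Set G) = {a, b, c} by ext; simp; tauto]
  obtain ⟨ha, hab⟩ := big a b c hgen hH
  obtain ⟨hb, hbc⟩ := big b c a hbca hH
  obtain ⟨hc, hca⟩ := big c a b hcab hH
  have hcomm := mul_comm_of_closure hgen (by
    rintro s (rfl | rfl | rfl) t (rfl | rfl | rfl)
    exacts [rfl, hab, hca.symm, hab.symm, rfl, hbc, hca, hbc.symm, rfl])
  have hsq : ∀ g : G, g * g = 1 := by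
    intro g
    have hg : g ∈ Subgroup.closure {a, b, c} := hgen ▸ Subgroup.mem_top g
    induction hg using Subgroup.closure_induction with
    | mem z hz => rcases hz with rfl | rfl | rfl <;> assumption
    | one => simp
    | mul z w _ _ hz hw => rw [mul_assoc, ← mul_assoc w, hcomm w z, mul_assoc, hw, mul_one, hz]
    | inv z _ hz => rw [← mul_inv_rev, hz, inv_one]
  exact hG (inSmallGroups_of_sq_eq_one hsq {a, b, c} (by simpa using hgen) Finset.card_le_three)
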